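/- Conventions. All dg-modules are over $\mathbf C$ and lower graded; $|f|$ denotes the degree of a homogeneous element $f$, the differential $\delta$ lowers the degree by $1$, and an upper degree $m$ is a lower degree $-m$. All signs follow the Koszul rule. Let $\mathcal O$ be a commutative $\mathbf C$-algebra with a Poisson structure, i.e. an antisymmetric biderivation $\{-,-\}:\mathcal O\otimes\mathcal O\to\mathcal O$ satisfying the Jacobi identity. Let $\epsilon:\tilde{\mathcal O}\to\mathcal O$ be a free (polynomial) dg-resolution of $\mathcal O$: $\tilde{\mathcal O}$ is a (graded) commutative dg-algebra which, as a graded commutative algebra, is freely generated by a family (finite or not) of homogeneous elements of degrees $\ge 0$, and $\epsilon$ is a quasi-isomorphism of dg-algebras onto $\mathcal O$ placed in degree $0$; that is, $\epsilon$ induces $H_0(\tilde{\mathcal O})\cong\mathcal O$, and $H_n(\tilde{\mathcal O})=0$ for $n\neq 0$. For $s\ge 0$ let $\Omega^s(\tilde{\mathcal O})$ be the module of Kähler $s$-forms, where $d(fg)=df\cdot g+(-1)^{|f|}f\cdot dg$, $|df|=|f|+1$, $df\cdot dg=(-1)^{|df||dg|}dg\cdot df$ and $\delta(df)=-d(\delta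 f)$. Let $T^s(\tilde{\mathcal O})^m=\mathrm{Hom}^m_{\tilde{\mathcal O}}(\Omega^s(\tilde{\mathcal O}),\tilde{\mathcal O})$ be the module of multivectors of order $s$ and upper degree $m$; equivalently, such a multivector $\pi$ is given by its values $\pi(df_1,\dots,df_s)$, which form an antisymmetric (in the graded sense) multiderivation of $\tilde{\mathcal O}$, with $|\pi(df_1,\dots,df_s)|=\sum_i(|f_i|+1)-m$. The differential of $\pi\in T^s(\tilde{\mathcal O})^m$ is $\delta(\pi)=\delta\circ\pi-(-1)^m\pi\circ\delta$. The Schouten–Nijenhuis bracket of $P\in T^s(\tilde{\mathcal O})^m$ and $Q\in T^t(\tilde{\mathcal O})^n$ is $[P,Q]=P\circ Q-(-1)^{(m-1)(n-1)}Q\circ P\in T^{s+t-1}(\tilde{\mathcal O})^{m+n-1}$, where $$P\circ Q(df_1,\dots,df_{s+t-1})=\sum\pm P(df_{i_1},\dots,df_{i_{s-1}},dQ(df_{j_1},\dots,df_{j_t})),$$ the sum being over all decompositions $\{1,\dots,s+t-1\}=\{i_1<\dots<i_{s-1}\}\sqcup\{j_1<\dots<j_t\}$ and $\pm$ being the Koszul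 sign of permuting the $df_i$ and of moving $dQ$, of upper degree $n-1$, across $df_{i_1},\dots,df_{i_{s-1}}$. **Theorem.** The algebra $\tilde{\mathcal O}$ carries a homotopy Poisson structure lifting the bracket of $\mathcal O$: there are multivectors $\tilde\pi_s\in T^s(\tilde{\mathcal O})^2$, $s\ge 2$, whose formal sum $\tilde\pi=\sum_s\tilde\pi_s$ satisfies the Maurer–Cartan equation $\delta(\tilde\pi)+\frac12[\tilde\pi,\tilde\pi]=0$, i.e. $$\delta(\tilde\pi_s)+\frac12\sum_{p+q=s+1,\ p,q\ge 2}[\tilde\pi_p,\tilde\pi_q]=0\qquad\text{for all } s\ge 2,$$ and such that $\epsilon(\tilde\pi_2(df,dg))=\{\epsilon(f),\epsilon(g)\}$ for all $f,g\in\tilde{\mathcal O}$. -/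

import Mathlib

namespace HoPoisson

/-- A Poisson structure on a commutative `ℂ`-algebra: an antisymmetric biderivation satisfying the
Jacobi identity. -/
structure IsPoisson {O : Type*} [CommRing O] [Algebra ℂ O] (br : O →ₗ[ℂ] O →ₗ[ℂ] O) : Prop where
  skew : ∀ f g, br f g = - br g f
  leibniz : ∀ f g h, br f (g * h) = br f g * h + g * br f h
  jacobi : ∀ f g h, br f (br g h) + br g (br h f) + br h (br f g) = 0

section DG

variable {A : Type*} [Ring A] [Algebra ℂ A]

/-- `A = ⨁ₙ 𝒜 n` (lower grading) with the differential `δ`, which lowers the degree by one, is a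
graded commutative differential graded algebra. -/
structure IsCommDGAlgebra (𝒜 : ℤ → Submodule ℂ A) [GradedAlgebra 𝒜] (δ : A →ₗ[ℂ] A) : Prop where
  mul_comm : ∀ p q a b, a ∈ 𝒜 p → b ∈ 𝒜 q → a * b = (p * q).negOnePow • (b * a)
  map_mem : ∀ p a, a ∈ 𝒜 p → δ a ∈ 𝒜 (p - 1)
  leibniz : ∀ p a b, a ∈ 𝒜 p → δ (a * b) = δ a * b + p.negOnePow • (a * δ b)
  square : ∀ a, δ (δ a) = 0

/-- As a graded commutative algebra, `A` is freely generated by the elements `u i`, homogeneous of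
degree `deg i ≥ 0`: it is the quotient of the free associative algebra on the `u i` by the
graded commutation relations between the generators. -/
structure IsPolynomialOn (𝒜 : ℤ → Submodule ℂ A) {ι : Type*} (deg : ι → ℕ) (u : ι → A) :
    Prop where
  mem : ∀ i, u i ∈ 𝒜 (deg i)
  surjective : Function.Surjective (FreeAlgebra.lift ℂ u)
  ker_eq : TwoSidedIdeal.ker (FreeAlgebra.lift ℂ u) =
    TwoSidedIdeal.span {x | ∃ i j, x = FreeAlgebra.ι ℂ i * FreeAlgebra.ι ℂ j -
      ((deg i : ℤ) * (deg j : ℤ)).negOnePow • (FreeAlgebra.ι ℂ j * FreeAlgebra.ι ℂ i)}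

/-- The algebra morphism `ε : A → O` is a morphism of dg-algebras onto `O`, concentrated in
degree `0` with zero differential, and it is a quasi-isomorphism: it induces an isomorphism on
`H₀` (fields `surjective`, `injective`) and `Hₙ(A) = 0` for `n ≠ 0` (field `exact`). -/
structure IsQuasiIsoAugmentation {O : Type*} [CommRing O] [Algebra ℂ O]
    (𝒜 : ℤ → Submodule ℂ A) (δ : A →ₗ[ℂ] A) (ε : A →ₐ[ℂ] O) : Prop where
  map_of_ne_zero : ∀ n a, n ≠ 0 → a ∈ 𝒜 n → ε a = 0
  map_differential : ∀ a, ε (δ a) = 0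
  surjective : ∀ o, ∃ a ∈ 𝒜 0, δ a = 0 ∧ ε a = o
  injective : ∀ a ∈ 𝒜 0, δ a = 0 → ε a = 0 → ∃ b ∈ 𝒜 1, δ b = a
  exact : ∀ n, n ≠ 0 → ∀ a ∈ 𝒜 n, δ a = 0 → ∃ b ∈ 𝒜 (n + 1), δ b = a

/-- `ε : A → O` is a free (polynomial) dg-resolution of `O`. -/
structure IsResolution {O : Type*} [CommRing O] [Algebra ℂ O]
    (𝒜 : ℤ → Submodule ℂ A) [GradedAlgebra 𝒜] (δ : A →ₗ[ℂ] A) {ι : Type*} (deg : ι → ℕ)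
    (u : ι → A) (ε : A →ₐ[ℂ] O) : Prop where
  dga : IsCommDGAlgebra 𝒜 δ
  polynomial : IsPolynomialOn 𝒜 deg u
  quasiIso : IsQuasiIsoAugmentation 𝒜 δ ε

/-- The multivectors `π ∈ T^s(A)^m = Hom^m_A(Ω^s(A), A)`, described by their values
`toFun ![f₁, …, fₛ] = π(df₁ ⋯ dfₛ)`, i.e. as antisymmetric multiderivations of `A`.
In all signs the symbol `df` has degree `|f| + 1` and `π` has upper degree `m`:
* `π` sends `df₁ ⋯ dfₛ` to an element of degree `∑ (|fᵢ| + 1) - m`;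
* `df dg = (-1)^{|df||dg|} dg df`;
* `d(ab) = da · b + (-1)^{|a|} a · db`, and `π` is `A`-linear, where `b` is carried to the right
  across the following `dfⱼ`, and `a` to the left across the preceding `dfⱼ` and across `π`. -/
structure Multivector (𝒜 : ℤ → Submodule ℂ A) (s : ℕ) (m : ℤ) where
  toFun : MultilinearMap ℂ (fun _ : Fin s => A) A
  map_mem : ∀ (d : Fin s → ℤ) (f : Fin s → A), (∀ i, f i ∈ 𝒜 (d i)) →
    toFun f ∈ 𝒜 (∑ i, (d i + 1) - m)
  antisymm : ∀ (d : Fin s → ℤ) (f : Fin s → A), (∀ i, f i ∈ 𝒜 (d i)) →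
    ∀ i j : Fin s, (i : ℕ) + 1 = j →
      toFun (f ∘ Equiv.swap i j) = ((d i + 1) * (d j + 1)).negOnePow • toFun f
  leibniz : ∀ (d : Fin s → ℤ) (f : Fin s → A), (∀ i, f i ∈ 𝒜 (d i)) →
    ∀ (i : Fin s) (p q : ℤ) (a b : A), a ∈ 𝒜 p → b ∈ 𝒜 q →
      toFun (Function.update f i (a * b)) =
        (q * ∑ j ∈ Finset.Ioi i, (d j + 1)).negOnePow • (toFun (Function.update f i a) * b) +
        (p * (1 + m + ∑ j ∈ Finset.Iio i, (d j + 1))).negOnePow •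
          (a * toFun (Function.update f i b))

variable {𝒜 : ℤ → Submodule ℂ A}

/-- The value `(δπ)(df₁ ⋯ dfₛ)`, for `fᵢ` homogeneous of degree `d i`, of the differential
`δ(π) = δ ∘ π - (-1)^m π ∘ δ` of a multivector of degree `m`. Here
`δ(df₁ ⋯ dfₛ) = ∑ᵢ ± df₁ ⋯ δ(dfᵢ) ⋯ dfₛ` and `δ(df) = - d(δ f)`. -/
def differentialEval (δ : A →ₗ[ℂ] A) {s : ℕ} {m : ℤ} (P : Multivector 𝒜 s m)
    (d : Fin s → ℤ) (f : Fin s → A) : A :=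
  δ (P.toFun f) - m.negOnePow •
    ∑ i, (∑ j ∈ Finset.Iio i, (d j + 1)).negOnePow • P.toFun (Function.update f i (- δ (f i)))

/-- The exponent of the Koszul sign of the rearrangement of `df₁ ⋯ df_N` into
`∏_{i ∈ I} dfᵢ · ∏_{j ∉ I} dfⱼ`, both products in increasing order, where `|fᵢ| = d i`. -/
def unshuffleExponent {N : ℕ} (d : Fin N → ℤ) (I : Finset (Fin N)) : ℤ :=
  ∑ i ∈ I, ∑ j ∈ Iᶜ with j < i, (d i + 1) * (d j + 1)

theorem card_compl_of_decomposition {k l N : ℕ} (h : k + l = N + 1) {I : Finset (Fin N)}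
    (hI : I.card + 1 = k) : Iᶜ.card = l := by
  rw [Finset.card_compl, Fintype.card_fin]
  omega

/-- The value on `df₁ ⋯ df_N`, `N = k + l - 1`, for `fᵢ` homogeneous of degree `d i`, of
`P ∘ Q = ∑ ± P(df_{i₁}, …, df_{i_{k-1}}, dQ(df_{j₁}, …, df_{j_l}))`, the sum over all decompositions
`{1, …, N} = {i₁ < … < i_{k-1}} ⊔ {j₁ < … < j_l}`. The sign is the Koszul sign of the
rearrangement of the `dfᵢ`, times that of carrying `dQ`, of upper degree `n - 1`, across
`df_{i₁}, …, df_{i_{k-1}}`. -/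
def circEval {k l N : ℕ} {m n : ℤ} (h : k + l = N + 1) (P : Multivector 𝒜 k m)
    (Q : Multivector 𝒜 l n) (d : Fin N → ℤ) (f : Fin N → A) : A :=
  ∑ I : {I : Finset (Fin N) // I.card + 1 = k},
    (unshuffleExponent d I.1 + (n - 1) * ∑ i ∈ I.1, (d i + 1)).negOnePow •
      P.toFun (fun a : Fin k =>
        Fin.snoc (α := fun _ => A) (fun i : Fin I.1.card => f (I.1.orderEmbOfFin rfl i))
          (Q.toFun (fun j : Fin l =>
            f (I.1ᶜ.orderEmbOfFin (card_compl_of_decomposition h I.2) j)))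
          (Fin.cast I.2.symm a))

/-- The value on `df₁ ⋯ df_N`, `N = k + l - 1`, for `fᵢ` homogeneous of degree `d i`, of the
Schouten–Nijenhuis bracket `[P, Q] = P ∘ Q - (-1)^{(m-1)(n-1)} Q ∘ P` of `P ∈ T^k(A)^m` and
`Q ∈ T^l(A)^n`. -/
def schoutenEval {k l N : ℕ} {m n : ℤ} (h : k + l = N + 1) (P : Multivector 𝒜 k m)
    (Q : Multivector 𝒜 l n) (d : Fin N → ℤ) (f : Fin N → A) : A :=
  circEval h P Q d f -
    ((m - 1) * (n - 1)).negOnePow • circEval ((Nat.add_comm l k).trans h) Q P d f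

/-- A sequence of multivectors `π_s ∈ T^s(A)^2`, `s ≥ 2` (the terms of order `0` and `1` are zero),
is a homotopy Poisson structure if `δ(π) + ½ [π, π] = 0` for `π = ∑ₛ π_s`, that is, in each order
`δ(π_s) + ½ ∑_{p+q=s+1} [π_p, π_q] = 0`; the equation is tested on all products `df₁ ⋯ dfₛ` with
homogeneous `fᵢ`, which generate `Ω^s(A)`. -/
structure IsHomotopyPoisson (δ : A →ₗ[ℂ] A) (π : (s : ℕ) → Multivector 𝒜 s 2) : Prop where
  zero_of_lt : ∀ s, s < 2 → (π s).toFun = 0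
  maurerCartan : ∀ s, 2 ≤ s → ∀ (d : Fin s → ℤ) (f : Fin s → A), (∀ i, f i ∈ 𝒜 (d i)) →
    differentialEval δ (π s) d f +
      (1 / 2 : ℂ) • ∑ x : {x : ℕ × ℕ // x ∈ Finset.HasAntidiagonal.antidiagonal (s + 1)},
        schoutenEval (Finset.HasAntidiagonal.mem_antidiagonal.1 x.2) (π x.1.1) (π x.1.2) d f = 0

end DG

end HoPoisson

namespace HoPoisson

/-! Adjoin the differential as a component of order 1. For F = δ + π₂ + π₃ + ⋯, of upper degree 2,
the equation F ∘ F = 0 contains both δ² = 0 and the Maurer–Cartan equation for the π_s. The square F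
∘ F = ½[F, F] is again a multiderivation (`squareEval_leib`), of upper degree 3. As the algebra is
free, F can be prescribed by any antisymmetric family of values on lists of generators
(`exists_partial`, `multivector`), and F ∘ F = 0 need only be checked on such lists
(`ext_of_weight_le`).

The values are built by induction on the weight of a list, the sum of the |uᵢ| + 1, rather than on
its length. In a term F(I, F(J)) of the square the outer list has weight one less than the total,
and, since each generator has weight at least 1, J has smaller weight than the total unless I is
empty. So a change of F in weight N + 1 and above changes the square in weight N + 1 only by δ of
that change (`squareEval_sub`). If the square vanishes up to weight N, the Bianchi identity, which
equates F ∘ (F ∘ F) and (F ∘ F) ∘ F up to Koszul signs (`unsh_square_app`), reduces in weight N + 1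
to δ(F ∘ F) = 0. The obstruction is thus a cycle of degree N - 2, and a primitive of its opposite is
the correction.

Weights below 3 put the square in negative degree, where it is zero; weights above 3 are handled by
acyclicity. In weight 3 the degree is 0, and ε of the square vanishes by the Jacobi identity and ε ∘
δ = 0 (`map_squareEval`). Averaging over permutations makes the primitive antisymmetric without
spoiling the equation, because the square already is. Lists of length 1 and lists of weight at most
2 are never corrected, so δ and the lift of the bracket survive. Each value stabilises, and
discarding the orders below 2 from the limit gives the homotopy Poisson structure. -/

theorem negOnePow_smul_congr {M : Type*} [AddCommGroup M] {a b : ℤ} (h : Even a ↔ Even b) (x : M) :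
    a.negOnePow • x = b.negOnePow • x := by
  have : Even (a - b) := by rw [Int.even_sub]; exact h
  rw [(Int.negOnePow_eq_iff a b).2 this]

/-- Comparing two Koszul signs becomes a polynomial identity between degrees over the field with two
elements. -/
theorem negOnePow_smul_congr_zmod {M : Type*} [AddCommGroup M] {a b : ℤ}
    (h : (a : ZMod 2) = (b : ZMod 2)) (x : M) : a.negOnePow • x = b.negOnePow • x := by
  refine negOnePow_smul_congr ?_ x
  rw [← ZMod.intCast_eq_zero_iff_even, ← ZMod.intCast_eq_zero_iff_even, h]

theorem neg_negOnePow_smul {M : Type*} [AddCommGroup M] (a : ℤ) (x : M) :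
    - (a.negOnePow • x) = (a + 1).negOnePow • x := by
  rw [Int.negOnePow_succ, Units.smul_def, Units.smul_def, Units.val_neg, neg_smul]

theorem zmod_two_mul_self (x : ZMod 2) : x * x = x := by
  revert x
  decide

theorem map_negOnePow_smul {M N : Type*} [AddCommGroup M] [AddCommGroup N] (φ : M →+ N) (a : ℤ)
    (x : M) : φ (a.negOnePow • x) = a.negOnePow • φ x := by
  rw [Units.smul_def, Units.smul_def, map_zsmul]

/-! ### Signed sums over unshuffles of a list. -/

section Unshuffle

variable {α M : Type*} [AddCommGroup M] (w : α → ℤ)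

/-- The total weight of a list. -/
def weight (L : List α) : ℤ := (L.map w).sum

@[simp] theorem weight_nil : weight w [] = 0 := rfl

@[simp] theorem weight_cons (x : α) (L : List α) : weight w (x :: L) = w x + weight w L := by
  simp [weight]

@[simp] theorem weight_append (L K : List α) : weight w (L ++ K) = weight w L + weight w K := by
  simp [weight]

theorem weight_perm {L K : List α} (h : L.Perm K) : weight w L = weight w K :=
  (h.map w).sum_eq

/-- The sum, with Koszul signs, of `G I J` over all ways to split a list into two complementary
sublists `I` and `J`. -/
def unsh : List α → (List α → List α → M) → M
  | [], G => G [] []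
  | x :: L, G => unsh L (fun I J => G (x :: I) J + (w x * weight w I).negOnePow • G I (x :: J))

variable {w}

theorem unsh_congr {L : List α} {G G' : List α → List α → M}
    (h : ∀ I J, (I ++ J).Perm L → G I J = G' I J) : unsh w L G = unsh w L G' := by
  induction L generalizing G G' with
  | nil => exact h [] [] (List.Perm.refl _)
  | cons x L ih =>
    refine ih fun I J hIJ => ?_
    rw [h (x :: I) J (hIJ.cons x), h I (x :: J) (List.perm_middle.trans (hIJ.cons x))]

theorem unsh_add (L : List α) (G G' : List α → List α → M) :
    unsh w L (fun I J => G I J + G' I J) = unsh w L G + unsh w L G' := by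
  induction L generalizing G G' with
  | nil => rfl
  | cons x L ih =>
    simp only [unsh]
    rw [← ih]
    congr 1
    funext I J
    rw [smul_add]
    abel

theorem map_unsh {N : Type*} [AddCommGroup N] (φ : M →+ N) (L : List α)
    (G : List α → List α → M) : φ (unsh w L G) = unsh w L (fun I J => φ (G I J)) := by
  induction L generalizing G with
  | nil => rfl
  | cons x L ih =>
    simp only [unsh]
    rw [ih]
    simp only [map_add, map_negOnePow_smul]

theorem unsh_smul (a : ℤ) (L : List α) (G : List α → List α → M) :
    unsh w L (fun I J => a.negOnePow • G I J) = a.negOnePow • unsh w L G :=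
  (map_unsh (DistribSMul.toAddMonoidHom M a.negOnePow) L G).symm

theorem unsh_neg (L : List α) (G : List α → List α → M) :
    unsh w L (fun I J => - G I J) = - unsh w L G :=
  (map_unsh (negAddMonoidHom : M →+ M) L G).symm

theorem unsh_zero (L : List α) : unsh w L (fun _ _ => (0 : M)) = 0 :=
  by
  simpa using (map_unsh (w := w) (0 : M →+ M) L fun _ _ => (0 : M)).symm

theorem unsh_eq_zero {L : List α} {G : List α → List α → M}
    (h : ∀ I J, (I ++ J).Perm L → G I J = 0) : unsh w L G = 0 :=
  (unsh_congr h).trans (unsh_zero L)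

/-- The recursion peels off the head of a list; this peels off the last element, which crosses the
right block to join the left one. It serves to expand a square evaluated on a list ending in a value
F(J). -/
theorem unsh_append_singleton (K : List α) (z : α) (G : List α → List α → M) :
    unsh w (K ++ [z]) G = unsh w K (fun I J =>
      (w z * weight w J).negOnePow • G (I ++ [z]) J + G I (J ++ [z])) := by
  induction K generalizing G with
  | nil => simp [unsh]
  | cons x K ih =>
    simp only [List.cons_append, unsh]
    rw [ih]
    congr 1
    funext I J
    simp only [smul_add, smul_smul, ← Int.negOnePow_add, weight_append, weight_cons, weight_nil]
    rw [negOnePow_smul_congr (a := w z * weight w J + w x * (weight w I + (w z + 0)))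
      (b := w x * weight w I + w z * (w x + weight w J))]
    · abel
    · simp only [Int.even_add, Int.even_mul, Even.zero]; tauto

/-- Coassociativity of the unshuffle coproduct: both sides distribute the list over three ordered
blocks. -/
theorem unsh_coassoc (L : List α) (G : List α → List α → List α → M) :
    unsh w L (fun K J => unsh w K (fun I I' => G I I' J)) =
      unsh w L (fun I K => unsh w K (fun I' J => G I I' J)) := by
  induction L generalizing G with
  | nil => rfl
  | cons x L ih =>
    -- The head x joins the first, second or third block, crossing the blocks before it.
    have h := ih (fun I I' J => G (x :: I) I' J + (w x * weight w I).negOnePow • G I (x :: I') J +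
      (w x * weight w I + w x * weight w I').negOnePow • G I I' (x :: J))
    simp only [unsh]
    refine Eq.trans ?_ (h.trans ?_)
    · congr 1
      funext K J
      rw [← unsh_smul, ← unsh_add]
      refine unsh_congr fun I I' hI => ?_
      rw [← weight_perm w hI, weight_append, mul_add]
    · congr 1
      funext I K
      rw [← unsh_smul, ← unsh_add]
      congr 1
      funext I' J
      rw [smul_add, smul_smul, ← Int.negOnePow_add, add_assoc]

/-- Graded cocommutativity of the unshuffle coproduct. All cancellations between pairs of cross
terms below rest on it. -/
theorem unsh_swap (L : List α) (G : List α → List α → M) :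
    unsh w L G = unsh w L (fun I J => (weight w I * weight w J).negOnePow • G J I) := by
  induction L generalizing G with
  | nil => simp [unsh]
  | cons x L ih =>
    simp only [unsh]
    rw [ih]
    congr 1
    funext I J
    simp only [smul_add, smul_smul, ← Int.negOnePow_add, weight_cons]
    rw [add_comm]
    congr 1 <;> refine negOnePow_smul_congr ?_ _ <;>
      (simp only [Int.even_add, Int.even_mul]; tauto)

theorem unsh_lin {R : Type*} [Ring R] [Module R M] {x y z : α} (r : R) (hx : w x = w z)
    (hy : w y = w z) {G : List α → List α → M}
    (h₁ : ∀ I I' J, G (I ++ z :: I') J = r • G (I ++ x :: I') J + G (I ++ y :: I') J)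
    (h₂ : ∀ I J J', G I (J ++ z :: J') = r • G I (J ++ x :: J') + G I (J ++ y :: J'))
    (L L' : List α) :
    unsh w (L ++ z :: L') G = r • unsh w (L ++ x :: L') G + unsh w (L ++ y :: L') G := by
  induction L generalizing G with
  | nil =>
    have hr : ∀ H : List α → List α → M, r • unsh w L' H = unsh w L' (fun I J => r • H I J) :=
      map_unsh (DistribSMul.toAddMonoidHom M r) L'
    simp only [List.nil_append, unsh]
    rw [hr, ← unsh_add]
    congr 1
    funext I J
    have e₁ := h₁ [] I J
    have e₂ := h₂ I [] J
    simp only [List.nil_append] at e₁ e₂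
    rw [e₁, e₂, hx, hy, Units.smul_def, Units.smul_def, Units.smul_def]
    simp only [smul_add, smul_comm r]
    abel
  | cons a L ih =>
    simp only [List.cons_append, unsh]
    refine ih (fun I I' J => ?_) (fun I J J' => ?_)
    · have e₁ := h₁ (a :: I) I' J
      have e₂ := h₁ I I' (a :: J)
      simp only [List.cons_append] at e₁ e₂
      simp only [weight_append, weight_cons]
      rw [e₁, e₂, hx, hy, Units.smul_def]
      simp only [smul_add, smul_comm r]
      abel
    · have e₁ := h₂ (a :: I) J J'
      have e₂ := h₂ I (a :: J) J'
      simp only [List.cons_append] at e₁ e₂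
      rw [e₁, e₂, Units.smul_def]
      simp only [smul_add, smul_comm r]
      abel

/-- If x and y fall into the same block, the hypotheses apply; if they are separated, exchanging
them exchanges two terms of the sum and the recursion supplies the sign. -/
theorem unsh_anti {x y : α} {G : List α → List α → M}
    (h₁ : ∀ I I' J, G (I ++ y :: x :: I') J = (w x * w y).negOnePow • G (I ++ x :: y :: I') J)
    (h₂ : ∀ I J J', G I (J ++ y :: x :: J') = (w x * w y).negOnePow • G I (J ++ x :: y :: J'))
    (L L' : List α) :
    unsh w (L ++ y :: x :: L') G = (w x * w y).negOnePow • unsh w (L ++ x :: y :: L') G := by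
  induction L generalizing G with
  | nil =>
    simp only [List.nil_append, unsh]
    rw [← unsh_smul]
    congr 1
    funext I J
    have e₁ := h₁ [] I J
    have e₂ := h₂ I [] J
    simp only [List.nil_append] at e₁ e₂
    rw [e₁, e₂]
    simp only [smul_add, smul_smul, ← Int.negOnePow_add, weight_cons]
    rw [negOnePow_smul_congr (a := w y * (w x + weight w I))
        (b := w x * w y + w y * weight w I),
      negOnePow_smul_congr (a := w x * weight w I)
        (b := w x * w y + w x * (w y + weight w I)),
      negOnePow_smul_congr (a := w x * weight w I + (w y * weight w I + w x * w y))
        (b := w x * w y + (w y * weight w I + w x * weight w I))]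
    · abel
    all_goals simp only [Int.even_add, Int.even_mul]; tauto
  | cons a L ih =>
    simp only [List.cons_append, unsh]
    refine ih (fun I I' J => ?_) (fun I J J' => ?_)
    · have e₁ := h₁ (a :: I) I' J
      have e₂ := h₁ I I' (a :: J)
      simp only [List.cons_append] at e₁ e₂
      simp only [weight_append, weight_cons]
      rw [e₁, e₂, add_left_comm (w y), smul_add, smul_comm]
    · have e₁ := h₂ (a :: I) J J'
      have e₂ := h₂ I (a :: J) J'
      simp only [List.cons_append] at e₁ e₂
      rw [e₁, e₂, smul_add, smul_comm]

end Unshuffle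

/-! ### Graded antisymmetrization over all permutations of a list. -/

section Symmetrization

variable {α M : Type*} [AddCommGroup M] (w : α → ℤ)

/-- The sum, with Koszul signs, of the values of `G` on the insertions of `x` into a list. -/
def insertSum (x : α) : (List α → M) → List α → M
  | G, [] => G [x]
  | G, y :: L => G (x :: y :: L) +
      (w x * w y).negOnePow • insertSum x (fun K => G (y :: K)) L

/-- The sum, with Koszul signs, of the values of `G` on all the permutations of a list. -/
def symmSum : (List α → M) → List α → M
  | G, [] => G []
  | G, x :: L => symmSum (insertSum w x G) L

variable {w}

theorem insertSum_add_smul (x : α) (a : ℤ) (G G' : List α → M) (L : List α) :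
    insertSum w x (fun K => G K + a.negOnePow • G' K) L =
      insertSum w x G L + a.negOnePow • insertSum w x G' L := by
  induction L generalizing G G' with
  | nil => rfl
  | cons y L ih =>
    simp only [insertSum]
    rw [ih, smul_add, smul_add, smul_comm]
    abel

theorem insertSum_comm (x y : α) (G : List α → M) (L : List α) :
    insertSum w y (insertSum w x G) L =
      (w x * w y).negOnePow • insertSum w x (insertSum w y G) L := by
  induction L generalizing G with
  | nil =>
    simp only [insertSum, smul_add, smul_smul, ← Int.negOnePow_add]
    rw [negOnePow_smul_congr (a := w x * w y + w y * w x) (b := 0), Int.negOnePow_zero, one_smul,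
      add_comm]
    simp only [Int.even_add, Int.even_mul, Even.zero]; tauto
  | cons z L ih =>
    simp only [insertSum, insertSum_add_smul, smul_add]
    rw [ih]
    simp only [smul_smul, ← Int.negOnePow_add]
    rw [negOnePow_smul_congr (a := w x * w y + w y * w x) (b := 0), Int.negOnePow_zero, one_smul,
      negOnePow_smul_congr (a := w x * w y + (w y * w x + w y * w z)) (b := w y * w z),
      negOnePow_smul_congr (a := w y * w z + (w x * w z + w x * w y))
        (b := w x * w y + (w x * w z + w y * w z))]
    · abel
    all_goals simp only [Int.even_add, Int.even_mul, Even.zero]; tauto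

theorem symmSum_smul (a : ℤ) (G : List α → M) (L : List α) :
    symmSum w (fun K => a.negOnePow • G K) L = a.negOnePow • symmSum w G L := by
  induction L generalizing G with
  | nil => rfl
  | cons x L ih =>
    simp only [symmSum]
    rw [← ih]
    congr 1
    funext K
    have : ∀ (G : List α → M),
        insertSum w x (fun K => a.negOnePow • G K) K = a.negOnePow • insertSum w x G K := by
      intro G
      induction K generalizing G with
      | nil => rfl
      | cons y K ih => simp only [insertSum, ih, smul_add, smul_comm a.negOnePow]
    exact this G

/-- The insertion operators of x and y commute up to their Koszul sign, so the full sum is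
antisymmetric whatever G is. -/
theorem symmSum_anti (x y : α) (G : List α → M) (L L' : List α) :
    symmSum w G (L ++ y :: x :: L') = (w x * w y).negOnePow • symmSum w G (L ++ x :: y :: L') := by
  induction L generalizing G with
  | nil =>
    simp only [List.nil_append, symmSum]
    rw [← symmSum_smul]
    congr 1
    funext K
    rw [insertSum_comm, mul_comm]
  | cons a L ih => exact ih _

theorem map_symmSum {N : Type*} [AddCommGroup N] (φ : M →+ N) (G : List α → M) (L : List α) :
    φ (symmSum w G L) = symmSum w (fun K => φ (G K)) L := by
  induction L generalizing G with
  | nil => rfl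
  | cons x L ih =>
    simp only [symmSum]
    rw [ih]
    congr 1
    funext K
    have : ∀ (G : List α → M), φ (insertSum w x G K) = insertSum w x (fun K => φ (G K)) K := by
      intro G
      induction K generalizing G with
      | nil => rfl
      | cons y K ih => simp only [insertSum, map_add, map_negOnePow_smul, ih]
    exact this G

theorem symmSum_mem (S : AddSubgroup M) {G : List α → M} {L : List α}
    (h : ∀ K, K.Perm L → G K ∈ S) : symmSum w G L ∈ S := by
  induction L generalizing G with
  | nil => exact h [] (List.Perm.refl _)
  | cons x L ih =>
    refine ih fun K hK => ?_
    have : ∀ (G : List α → M), (∀ K', K'.Perm (x :: K) → G K' ∈ S) → insertSum w x G K ∈ S := by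
      clear hK
      intro G hG
      induction K generalizing G with
      | nil => exact hG _ (List.Perm.refl _)
      | cons y K ih =>
        refine S.add_mem (hG _ (List.Perm.refl _)) ?_
        rw [Units.smul_def]
        exact S.zsmul_mem (ih _ fun K' hK' => hG _ ((hK'.cons y).trans (List.Perm.swap x y K))) _
    exact this G fun K' hK' => h K' (hK'.trans (hK.cons x))

/-- All permutations contribute equally once the sign is accounted for. Dividing by the factorial
thus gives a projection onto antisymmetric families, which is why averaging primitives keeps the
equation they solve. -/
theorem symmSum_of_anti {G : List α → M}
    (h : ∀ L x y L', G (L ++ y :: x :: L') = (w x * w y).negOnePow • G (L ++ x :: y :: L'))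
    (L : List α) : symmSum w G L = L.length.factorial • G L := by
  have key : ∀ (x : α) (K : List α) (G : List α → M),
      (∀ L x y L', G (L ++ y :: x :: L') = (w x * w y).negOnePow • G (L ++ x :: y :: L')) →
      insertSum w x G K = (K.length + 1) • G (x :: K) := by
    intro x K
    induction K with
    | nil => intro G _; simp [insertSum]
    | cons y K ih =>
      intro G hG
      simp only [insertSum]
      rw [ih (fun K => G (y :: K)) fun L a b L' => hG (y :: L) a b L',
        show G (y :: x :: K) = _ from hG [] x y K, List.nil_append, smul_comm, smul_smul,
        ← Int.negOnePow_add, Int.negOnePow_even _ ⟨_, rfl⟩, one_smul, List.length_cons,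
        succ_nsmul (G (x :: y :: K)) (K.length + 1), add_comm]
  induction L generalizing G with
  | nil => simp [symmSum]
  | cons x L ih =>
    simp only [symmSum]
    have e : insertSum w x G = fun K => (K.length + 1) • G (x :: K) := funext fun K => key x K G h
    rw [e, ih fun L a b L' => ?_, smul_smul, List.length_cons, Nat.factorial_succ, mul_comm]
    rw [show G (x :: (L ++ b :: a :: L')) = _ from h (x :: L) a b L', smul_comm]
    simp

end Symmetrization

/-! ### Multivectors of mixed order on homogeneous elements, their square and the Bianchi identity.
-/

section Homogeneous

variable {A : Type*} [Ring A] [Algebra ℂ A]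

/-- A homogeneous element together with its degree. -/
@[ext]
structure Homog (𝒜 : ℤ → Submodule ℂ A) where
  deg : ℤ
  val : A
  mem : val ∈ 𝒜 deg

/-- The degree `|f| + 1` of the symbol `df`. -/
def Homog.wt {𝒜 : ℤ → Submodule ℂ A} (x : Homog 𝒜) : ℤ := x.deg + 1

/-- A multivector of upper degree `m`, of mixed orders, given by its values on lists of homogeneous
elements. -/
structure HomogMultivector (𝒜 : ℤ → Submodule ℂ A) (m : ℤ) where
  toFun : List (Homog 𝒜) → A
  mem : ∀ L, toFun L ∈ 𝒜 (weight Homog.wt L - m)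
  lin : ∀ (L L' : List (Homog 𝒜)) (r : ℂ) (x y z : Homog 𝒜), x.deg = z.deg → y.deg = z.deg →
    z.val = r • x.val + y.val →
    toFun (L ++ z :: L') = r • toFun (L ++ x :: L') + toFun (L ++ y :: L')
  anti : ∀ (L : List (Homog 𝒜)) (x y : Homog 𝒜) (L' : List (Homog 𝒜)),
    toFun (L ++ y :: x :: L') = (x.wt * y.wt).negOnePow • toFun (L ++ x :: y :: L')
  leib : ∀ (x y z : Homog 𝒜) (L : List (Homog 𝒜)), z.deg = x.deg + y.deg → z.val = x.val * y.val →
    toFun (z :: L) = (y.deg * weight Homog.wt L).negOnePow • (toFun (x :: L) * y.val) +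
      (x.deg * (1 + m)).negOnePow • (x.val * toFun (y :: L))

variable {𝒜 : ℤ → Submodule ℂ A}

theorem eq_zero_of_eq_neg {a : A} (h : a = - a) : a = 0 := by
  have h2 : (2 : ℂ) • a = 0 := by
    rw [two_smul]
    nth_rewrite 2 [h]
    exact add_neg_cancel a
  calc a = (2⁻¹ : ℂ) • (2 : ℂ) • a := by rw [smul_smul, inv_mul_cancel₀ two_ne_zero, one_smul]
    _ = 0 := by rw [h2, smul_zero]

namespace HomogMultivector

variable {m : ℤ} (F : HomogMultivector 𝒜 m)

/-- The value of a multivector, as a homogeneous element. -/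
def app (L : List (Homog 𝒜)) : Homog 𝒜 := ⟨weight Homog.wt L - m, F.toFun L, F.mem L⟩

theorem map_zero (L L' : List (Homog 𝒜)) {z : Homog 𝒜} (hz : z.val = 0) :
    F.toFun (L ++ z :: L') = 0 := by
  -- For r = 1 and x = y = z, linearity reads F(z) = F(z) + F(z).
  simpa using F.lin L L' 1 z z z rfl rfl (by simp [hz])

theorem map_sign (L L' : List (Homog 𝒜)) (a : ℤ) {x z : Homog 𝒜} (hx : x.deg = z.deg)
    (h : z.val = a.negOnePow • x.val) :
    F.toFun (L ++ z :: L') = a.negOnePow • F.toFun (L ++ x :: L') := by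
  have hs : ∀ b : A, a.negOnePow • b = ((a.negOnePow : ℤ) : ℂ) • b := fun b => by
    rw [Units.smul_def, Int.cast_smul_eq_zsmul]
  have := F.lin L L' ((a.negOnePow : ℤ) : ℂ) x ⟨z.deg, 0, (𝒜 _).zero_mem⟩ z hx rfl
    (by rw [h, hs, add_zero])
  rw [this, F.map_zero L L' (z := ⟨z.deg, 0, (𝒜 _).zero_mem⟩) rfl, add_zero, hs]

theorem map_sign_add (L L' : List (Homog 𝒜)) (a b : ℤ) {x y z : Homog 𝒜} (hx : x.deg = z.deg)
    (hy : y.deg = z.deg) (h : z.val = a.negOnePow • x.val + b.negOnePow • y.val) :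
    F.toFun (L ++ z :: L') =
      a.negOnePow • F.toFun (L ++ x :: L') + b.negOnePow • F.toFun (L ++ y :: L') := by
  have hb : b.negOnePow • y.val ∈ 𝒜 z.deg := by
    rw [Units.smul_def, ← hy]
    exact zsmul_mem y.mem _
  have hs : ∀ c : A, a.negOnePow • c = ((a.negOnePow : ℤ) : ℂ) • c := fun c => by
    rw [Units.smul_def, Int.cast_smul_eq_zsmul]
  rw [F.lin L L' ((a.negOnePow : ℤ) : ℂ) x ⟨z.deg, _, hb⟩ z hx rfl (by rw [h, hs]), hs]
  congr 1
  exact F.map_sign L L' b hy rfl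

theorem move_last (L K : List (Homog 𝒜)) (x : Homog 𝒜) :
    F.toFun (L ++ x :: K) = (x.wt * weight Homog.wt K).negOnePow • F.toFun (L ++ K ++ [x]) := by
  induction K generalizing L with
  | nil => simp
  | cons y K ih =>
    rw [F.anti, List.append_cons, ih, smul_smul, ← Int.negOnePow_add]
    simp only [List.append_assoc, List.singleton_append, weight_cons]
    refine negOnePow_smul_congr ?_ _
    simp only [Int.even_add, Int.even_mul]
    tauto

/-- The structure only demands the Leibniz rule in the first slot; antisymmetry carries it to the
others, and the left factor picks up the sign of crossing the preceding symbols. -/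
theorem leib_at (L L' : List (Homog 𝒜)) (x y z : Homog 𝒜) (hd : z.deg = x.deg + y.deg)
    (hv : z.val = x.val * y.val) :
    F.toFun (L ++ z :: L') =
      (y.deg * weight Homog.wt L').negOnePow • (F.toFun (L ++ x :: L') * y.val) +
      (x.deg * (1 + m + weight Homog.wt L)).negOnePow • (x.val * F.toFun (L ++ y :: L')) := by
  induction L using List.reverseRecOn generalizing L' with
  | nil => simpa using F.leib x y z L' hd hv
  | append_singleton L c ih =>
    simp only [List.append_assoc, List.singleton_append]
    rw [F.anti L z c L', ih, F.anti L c x L', F.anti L c y L']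
    simp only [smul_add, smul_smul, mul_smul_comm, smul_mul_assoc, ← Int.negOnePow_add,
      weight_cons, weight_append, weight_nil]
    have hz : z.wt = x.deg + y.deg + 1 := by rw [Homog.wt, hd]
    have hx : x.wt = x.deg + 1 := rfl
    have hy : y.wt = y.deg + 1 := rfl
    rw [hx, hy, hz]
    congr 1 <;> refine negOnePow_smul_congr_zmod ?_ _ <;> push_cast <;> grind

/-- The term, for the decomposition `(I, J)` of a list, of the square of a multivector of upper
degree `2` for the Nijenhuis–Richardson product. -/
def squareTerm (F : HomogMultivector 𝒜 2) (I J : List (Homog 𝒜)) : A :=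
  (weight Homog.wt I).negOnePow • F.toFun (I ++ [F.app J])

/-- The square of a multivector of upper degree `2` for the Nijenhuis–Richardson product. -/
def squareEval (F : HomogMultivector 𝒜 2) (L : List (Homog 𝒜)) : A :=
  unsh Homog.wt L F.squareTerm

theorem unsh_mem {α : Type*} {w : α → ℤ} (S : Submodule ℂ A) {L : List α}
    {G : List α → List α → A} (h : ∀ I J, (I ++ J).Perm L → G I J ∈ S) : unsh w L G ∈ S := by
  -- Membership in S is tested by passing to the quotient by S, where every term dies.
  have := map_unsh (w := w) (S.mkQ.toAddMonoidHom) L G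
  simp only [LinearMap.toAddMonoidHom_coe, Submodule.mkQ_apply] at this
  rw [unsh_eq_zero fun I J hIJ => (Submodule.Quotient.mk_eq_zero S).2 (h I J hIJ)] at this
  exact (Submodule.Quotient.mk_eq_zero S).1 this

theorem squareTerm_mem (F : HomogMultivector 𝒜 2) {I J L : List (Homog 𝒜)}
    (h : (I ++ J).Perm L) : F.squareTerm I J ∈ 𝒜 (weight Homog.wt L - 3) := by
  rw [squareTerm, Units.smul_def]
  refine zsmul_mem ?_ _
  have := F.mem (I ++ [F.app J])
  rw [← weight_perm _ h]
  convert this using 2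
  simp only [weight_append, weight_cons, weight_nil, Homog.wt, app]
  ring

theorem squareEval_mem (F : HomogMultivector 𝒜 2) (L : List (Homog 𝒜)) :
    F.squareEval L ∈ 𝒜 (weight Homog.wt L - 3) := by
  exact unsh_mem _ fun I J h => F.squareTerm_mem h

theorem squareEval_lin (F : HomogMultivector 𝒜 2) (L L' : List (Homog 𝒜)) (r : ℂ)
    (x y z : Homog 𝒜) (hx : x.deg = z.deg) (hy : y.deg = z.deg) (hv : z.val = r • x.val + y.val) :
    F.squareEval (L ++ z :: L') = r • F.squareEval (L ++ x :: L') + F.squareEval (L ++ y :: L') := by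
  have hx' : x.wt = z.wt := by rw [Homog.wt, Homog.wt, hx]
  have hy' : y.wt = z.wt := by rw [Homog.wt, Homog.wt, hy]
  refine unsh_lin r hx' hy' (fun I I' J => ?_) (fun I J J' => ?_) L L'
  · simp only [squareTerm, weight_append, weight_cons, hx', hy', List.append_assoc,
      List.cons_append, F.lin I _ r x y z hx hy hv]
    rw [smul_add, smul_comm]
  · rw [squareTerm, F.lin I [] r (F.app (J ++ x :: J')) (F.app (J ++ y :: J')), squareTerm,
      squareTerm, smul_add, smul_comm]
    · simp only [app, weight_append, weight_cons, hx']
    · simp only [app, weight_append, weight_cons, hy']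
    · exact F.lin J J' r x y z hx hy hv

theorem squareEval_anti (F : HomogMultivector 𝒜 2) (L : List (Homog 𝒜)) (x y : Homog 𝒜)
    (L' : List (Homog 𝒜)) : F.squareEval (L ++ y :: x :: L') =
      (x.wt * y.wt).negOnePow • F.squareEval (L ++ x :: y :: L') := by
  refine unsh_anti (fun I I' J => ?_) (fun I J J' => ?_) L L'
  · simp only [squareTerm, weight_append, weight_cons, List.append_assoc, List.cons_append,
      F.anti I x y]
    rw [smul_comm, add_left_comm x.wt]
  · rw [squareTerm, F.map_sign I [] (x.wt * y.wt) (x := F.app (J ++ x :: y :: J')), squareTerm,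
      smul_comm]
    · simp only [app, weight_append, weight_cons]
      ring
    · exact F.anti J x y J'

/-- Expanding F(I, F(xy, J)) by the Leibniz rule twice gives the wanted terms together with two
cross terms, in which x and y sit in different factors F. These do not cancel for one decomposition,
but exchanging I and J matches them with opposite signs. This is why the square, unlike a general
product P ∘ Q, is a multiderivation. -/
theorem squareEval_leib [GradedAlgebra 𝒜] (F : HomogMultivector 𝒜 2) (x y z : Homog 𝒜)
    (L : List (Homog 𝒜)) (hd : z.deg = x.deg + y.deg) (hv : z.val = x.val * y.val) :
    F.squareEval (z :: L) =
      (y.deg * weight Homog.wt L).negOnePow • (F.squareEval (x :: L) * y.val) +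
      (x.deg * (1 + 3)).negOnePow • (x.val * F.squareEval (y :: L)) := by
  have hz : z.wt = x.deg + y.deg + 1 := by rw [Homog.wt, hd]
  have hx : x.wt = x.deg + 1 := rfl
  have hy : y.wt = y.deg + 1 := rfl
  -- `D` is the cross term where the inner F takes x and the outer one differentiates y; `B` is the
  -- one where the outer F takes x and the inner one y.
  set D : List (Homog 𝒜) → List (Homog 𝒜) → A := fun I J =>
    (z.wt * weight Homog.wt I + weight Homog.wt I + y.deg * weight Homog.wt J +
      (x.deg + 1 + weight Homog.wt J) * (1 + weight Homog.wt I)).negOnePow •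
      (F.toFun (x :: J) * F.toFun (I ++ [y])) with hD
  set B : List (Homog 𝒜) → List (Homog 𝒜) → A := fun I J =>
    (z.wt * weight Homog.wt I + weight Homog.wt I + x.deg).negOnePow •
      (F.toFun (I ++ [x]) * F.toFun (y :: J)) with hB
  have hDB : unsh Homog.wt L D = - unsh Homog.wt L B := by
    rw [unsh_swap, ← unsh_neg]
    congr 1
    funext I J
    have e₁ := F.move_last [] I x
    have e₂ := F.move_last [] J y
    simp only [List.nil_append] at e₁ e₂
    simp only [hD, hB, e₁, e₂, smul_smul, mul_smul_comm, smul_mul_assoc, ← Int.negOnePow_add]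
    rw [neg_negOnePow_smul]
    refine negOnePow_smul_congr_zmod ?_ _
    rw [hx, hy, hz]
    push_cast
    grind
  have hR : (y.deg * weight Homog.wt L).negOnePow • (F.squareEval (x :: L) * y.val) +
      (x.deg * (1 + 3)).negOnePow • (x.val * F.squareEval (y :: L)) =
      unsh Homog.wt L (fun I J => (y.deg * (weight Homog.wt I + weight Homog.wt J)).negOnePow •
        ((F.squareTerm (x :: I) J +
          (x.wt * weight Homog.wt I).negOnePow • F.squareTerm I (x :: J)) * y.val) +
        (x.deg * (1 + 3)).negOnePow • (x.val * (F.squareTerm (y :: I) J +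
          (y.wt * weight Homog.wt I).negOnePow • F.squareTerm I (y :: J)))) := by
    rw [unsh_add, unsh_smul, squareEval, squareEval, unsh, unsh]
    congr 1
    · have := map_unsh (w := Homog.wt) (AddMonoidHom.mulRight y.val) L (fun I J =>
        F.squareTerm (x :: I) J + (x.wt * weight Homog.wt I).negOnePow • F.squareTerm I (x :: J))
      simp only [AddMonoidHom.coe_mulRight] at this
      rw [this, ← unsh_smul]
      refine unsh_congr fun I J h => ?_
      rw [← weight_perm _ h, weight_append]
    · have := map_unsh (w := Homog.wt) (AddMonoidHom.mulLeft x.val) L (fun I J =>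
        F.squareTerm (y :: I) J + (y.wt * weight Homog.wt I).negOnePow • F.squareTerm I (y :: J))
      simp only [AddMonoidHom.coe_mulLeft] at this
      rw [this]
  -- The vanishing sum of the cross terms is added to the right-hand side, so that the identity can
  -- be checked for each decomposition separately.
  rw [hR, ← add_zero (unsh _ _ _), ← neg_add_cancel (unsh Homog.wt L B), ← hDB, ← unsh_add,
    ← unsh_add, squareEval, unsh]
  congr 1
  funext I J
  have h₁ : F.squareTerm (z :: I) J =
      (y.deg * (weight Homog.wt I + weight Homog.wt J)).negOnePow •
        (F.squareTerm (x :: I) J * y.val) +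
      (x.deg * (1 + 3)).negOnePow • (x.val * F.squareTerm (y :: I) J) := by
    simp only [squareTerm, List.cons_append, F.leib x y z (I ++ [F.app J]) hd hv, smul_add,
      smul_smul, mul_smul_comm, smul_mul_assoc, ← Int.negOnePow_add, weight_cons, weight_append,
      weight_nil]
    rw [hx, hy, hz, show (F.app J).wt = weight Homog.wt J - 2 + 1 from rfl]
    congr 1 <;> refine negOnePow_smul_congr_zmod ?_ _ <;> push_cast <;> grind
  have h₂ : (z.wt * weight Homog.wt I).negOnePow • F.squareTerm I (z :: J) =
      (y.deg * (weight Homog.wt I + weight Homog.wt J)).negOnePow •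
        ((x.wt * weight Homog.wt I).negOnePow • F.squareTerm I (x :: J) * y.val) + D I J +
      (B I J + (x.deg * (1 + 3)).negOnePow •
        (x.val * (y.wt * weight Homog.wt I).negOnePow • F.squareTerm I (y :: J))) := by
    have mem₁ : F.toFun (x :: J) * y.val ∈ 𝒜 ((F.app (x :: J)).deg + y.deg) :=
      SetLike.mul_mem_graded (F.mem _) y.mem
    have mem₂ : x.val * F.toFun (y :: J) ∈ 𝒜 (x.deg + (F.app (y :: J)).deg) :=
      SetLike.mul_mem_graded x.mem (F.mem _)
    have e := F.map_sign_add I [] (y.deg * weight Homog.wt J) (x.deg * (1 + 2))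
      (x := ⟨_, _, mem₁⟩) (y := ⟨_, _, mem₂⟩) (z := F.app (z :: J))
      (by simp only [app, weight_cons, hx, hz]; ring)
      (by simp only [app, weight_cons, hy, hz]; ring) (F.leib x y z J hd hv)
    rw [F.leib_at I [] (F.app (x :: J)) y ⟨_, _, mem₁⟩ rfl rfl,
      F.leib_at I [] x (F.app (y :: J)) ⟨_, _, mem₂⟩ rfl rfl] at e
    simp only [squareTerm, e, hD, hB, smul_add, smul_smul, mul_smul_comm, smul_mul_assoc,
      ← Int.negOnePow_add, weight_nil]
    rw [show (F.app (x :: J)).deg = x.deg + 1 + weight Homog.wt J - 2 by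
      simp only [app, weight_cons, hx], hx, hy, hz]
    refine congrArg₂ _ (congrArg₂ _ ?_ ?_) (congrArg₂ _ ?_ ?_) <;>
      refine negOnePow_smul_congr_zmod ?_ _ <;> push_cast <;> grind
  rw [h₁, h₂]
  simp only [smul_add, add_mul, mul_add]
  abel

/-- The additive map `a ↦ F (I, aₙ)`, where `aₙ` is the component of degree `n` of `a`. -/
def lastHom [GradedAlgebra 𝒜] (F : HomogMultivector 𝒜 m) (I : List (Homog 𝒜)) (n : ℤ) : A →+ A where
  toFun a := F.toFun (I ++ [⟨n, DirectSum.decompose 𝒜 a n, SetLike.coe_mem _⟩])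
  map_zero' := F.map_zero I [] (by simp)
  map_add' a b := by
    have := F.lin I [] 1 ⟨n, DirectSum.decompose 𝒜 a n, SetLike.coe_mem _⟩
      ⟨n, DirectSum.decompose 𝒜 b n, SetLike.coe_mem _⟩
      ⟨n, DirectSum.decompose 𝒜 (a + b) n, SetLike.coe_mem _⟩ rfl rfl
      (by simp [DirectSum.decompose_add])
    rwa [one_smul] at this

theorem lastHom_apply [GradedAlgebra 𝒜] (F : HomogMultivector 𝒜 m) (I : List (Homog 𝒜))
    (x : Homog 𝒜) : F.lastHom I x.deg x.val = F.toFun (I ++ [x]) := by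
  rw [lastHom, AddMonoidHom.coe_mk, ZeroHom.coe_mk]
  congr 3
  ext
  · rfl
  · exact DirectSum.decompose_of_mem_same 𝒜 x.mem

/-- The square of a multivector of upper degree `2`, as a multivector of upper degree `3`. -/
def square [GradedAlgebra 𝒜] (F : HomogMultivector 𝒜 2) : HomogMultivector 𝒜 3 where
  toFun := F.squareEval
  mem := F.squareEval_mem
  lin := F.squareEval_lin
  anti := F.squareEval_anti
  leib := F.squareEval_leib

/-- In F²(I, F(J)) the entry F(J) falls either into the inner list, giving F(I₁, F(I₂, F(J))), or
into the outer one, giving F(I₁, F(J), F(I₂)). By coassociativity the first kind sums to the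
left-hand side. The second kind sums to zero, since exchanging the two blocks reverses the sign. -/
theorem unsh_square_app [GradedAlgebra 𝒜] (F : HomogMultivector 𝒜 2) (L : List (Homog 𝒜)) :
    unsh Homog.wt L (fun I J => F.toFun (I ++ [F.square.app J])) =
      unsh Homog.wt L
        (fun I J => (weight Homog.wt I).negOnePow • F.squareEval (I ++ [F.app J])) := by
  have hlin : ∀ I K : List (Homog 𝒜), F.toFun (I ++ [F.square.app K]) = unsh Homog.wt K
      (fun I' J => (weight Homog.wt I').negOnePow •
        F.toFun (I ++ [F.app (I' ++ [F.app J])])) := by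
    intro I K
    -- The inner value is a sum whose terms are homogeneous of one degree; `lastHom` turns the last
    -- slot into an additive map so that the sum can be pulled out.
    rw [← lastHom_apply, show (F.square.app K).val = unsh Homog.wt K F.squareTerm from rfl,
      map_unsh]
    refine unsh_congr fun I' J h => ?_
    rw [squareTerm, map_negOnePow_smul, ← lastHom_apply F I (F.app (I' ++ [F.app J])),
      show (F.square.app K).deg = (F.app (I' ++ [F.app J])).deg by
        simp only [app, ← weight_perm _ h, weight_append, weight_cons, weight_nil, Homog.wt]
        ring]
    rfl
  set C : List (Homog 𝒜) → List (Homog 𝒜) → List (Homog 𝒜) → A := fun I I' J =>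
    (weight Homog.wt I' * weight Homog.wt J + weight Homog.wt J + 1).negOnePow •
      F.toFun (I ++ [F.app J, F.app I']) with hC
  have hC0 : ∀ I K, unsh Homog.wt K (fun I' J => C I I' J) = 0 := by
    intro I K
    -- Cocommutativity shows that the sum equals its own negative, hence is zero over ℂ.
    have h := unsh_swap (w := Homog.wt) K (fun I' J => C I I' J)
    have : (fun I' J => (weight Homog.wt I' * weight Homog.wt J).negOnePow • C I J I') =
        fun I' J => - C I I' J := by
      funext I' J
      simp only [hC]
      rw [F.anti I (F.app J) (F.app I') [], neg_negOnePow_smul, smul_smul, smul_smul,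
        ← Int.negOnePow_add, ← Int.negOnePow_add]
      refine negOnePow_smul_congr_zmod ?_ _
      rw [show (F.app J).wt = weight Homog.wt J - 2 + 1 from rfl,
        show (F.app I').wt = weight Homog.wt I' - 2 + 1 from rfl]
      push_cast
      grind
    rw [this, unsh_neg] at h
    exact eq_zero_of_eq_neg h
  have hexp : ∀ I J, (weight Homog.wt I).negOnePow • F.squareEval (I ++ [F.app J]) =
      unsh Homog.wt I (fun I₁ I₂ => C I₁ I₂ J +
        (weight Homog.wt I₂).negOnePow • F.toFun (I₁ ++ [F.app (I₂ ++ [F.app J])])) := by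
    intro I J
    rw [squareEval, unsh_append_singleton, ← unsh_smul]
    refine unsh_congr fun I₁ I₂ h => ?_
    simp only [squareTerm, hC, smul_add, smul_smul, ← Int.negOnePow_add, ← weight_perm _ h,
      List.append_assoc, List.cons_append, List.nil_append, weight_append, weight_cons, weight_nil]
    rw [show (F.app J).wt = weight Homog.wt J - 2 + 1 from rfl]
    congr 1 <;> refine negOnePow_smul_congr_zmod ?_ _ <;> push_cast <;> grind
  simp only [hlin, hexp]
  rw [unsh_coassoc L (fun I₁ I₂ J => C I₁ I₂ J +
    (weight Homog.wt I₂).negOnePow • F.toFun (I₁ ++ [F.app (I₂ ++ [F.app J])]))]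
  congr 1
  funext I K
  rw [unsh_add, hC0, zero_add]

end HomogMultivector
end Homogeneous
-- Free graded commutative algebras: universal property, induction and partial derivatives.
section Polynomial

variable {A : Type*} [Ring A] [Algebra ℂ A] {𝒜 : ℤ → Submodule ℂ A}
  {ι : Type*} {deg : ι → ℕ} {u : ι → A}

namespace IsPolynomialOn

/-- The universal property of the free graded commutative algebra. -/
theorem exists_algHom (hp : IsPolynomialOn 𝒜 deg u) {B : Type*} [Ring B] [Algebra ℂ B] (g : ι → B)
    (hg : ∀ i j, g i * g j = ((deg i : ℤ) * (deg j : ℤ)).negOnePow • (g j * g i)) :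
    ∃ φ : A →ₐ[ℂ] B, ∀ i, φ (u i) = g i := by
  have hle : TwoSidedIdeal.ker (FreeAlgebra.lift ℂ u) ≤
      TwoSidedIdeal.ker (FreeAlgebra.lift ℂ g) := by
    rw [hp.ker_eq, TwoSidedIdeal.span_le]
    rintro _ ⟨i, j, rfl⟩
    rw [SetLike.mem_coe, TwoSidedIdeal.mem_ker, map_sub, sub_eq_zero]
    have := map_negOnePow_smul (FreeAlgebra.lift ℂ g).toRingHom.toAddMonoidHom
      ((deg i : ℤ) * (deg j : ℤ)) (FreeAlgebra.ι ℂ j * FreeAlgebra.ι ℂ i)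
    simp only [RingHom.toAddMonoidHom_eq_coe, AddMonoidHom.coe_coe, AlgHom.toRingHom_eq_coe,
      RingHom.coe_coe] at this
    rw [this, map_mul, map_mul, FreeAlgebra.lift_ι_apply, FreeAlgebra.lift_ι_apply, hg]
  have key : ∀ x y, FreeAlgebra.lift ℂ u x = FreeAlgebra.lift ℂ u y →
      FreeAlgebra.lift ℂ g x = FreeAlgebra.lift ℂ g y := by
    intro x y h
    rw [← sub_eq_zero, ← map_sub] at h ⊢
    exact (TwoSidedIdeal.mem_ker _).1 (hle ((TwoSidedIdeal.mem_ker _).2 h))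
  have hs := Function.surjInv_eq hp.surjective
  refine ⟨{ toFun := fun a => FreeAlgebra.lift ℂ g (Function.surjInv hp.surjective a)
            map_one' := ?_, map_mul' := ?_, map_zero' := ?_, map_add' := ?_, commutes' := ?_ }, ?_⟩
  · rw [← map_one (FreeAlgebra.lift ℂ g)]
    exact key _ _ (by rw [hs, map_one])
  · intro a b
    rw [← map_mul]
    exact key _ _ (by rw [hs, map_mul, hs, hs])
  · rw [← map_zero (FreeAlgebra.lift ℂ g)]
    exact key _ _ (by rw [hs, map_zero])
  · intro a b
    change FreeAlgebra.lift ℂ g _ = FreeAlgebra.lift ℂ g _ + FreeAlgebra.lift ℂ g _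
    rw [← map_add]
    exact key _ _ (by rw [hs, map_add, hs, hs])
  · intro r
    rw [← AlgHom.commutes (FreeAlgebra.lift ℂ g)]
    exact key _ _ (by rw [hs, AlgHom.commutes])
  · intro i
    change FreeAlgebra.lift ℂ g _ = _
    rw [← FreeAlgebra.lift_ι_apply (R := ℂ) g i]
    exact key _ _ (by rw [hs, FreeAlgebra.lift_ι_apply])

theorem induction (hp : IsPolynomialOn 𝒜 deg u) {P : A → Prop} (one : P 1) (gen : ∀ i, P (u i))
    (mul : ∀ a b, P a → P b → P (a * b)) (add : ∀ a b, P a → P b → P (a + b))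
    (smul : ∀ (r : ℂ) a, P a → P (r • a)) (a : A) : P a := by
  obtain ⟨x, rfl⟩ := hp.surjective a
  induction x with
  | grade0 r =>
    rw [AlgHom.commutes, Algebra.algebraMap_eq_smul_one]
    exact smul r 1 one
  | grade1 i => rw [FreeAlgebra.lift_ι_apply]; exact gen i
  | mul a b ha hb => rw [map_mul]; exact mul _ _ ha hb
  | add a b ha hb => rw [map_add]; exact add _ _ ha hb

theorem mem_span_prod (hp : IsPolynomialOn 𝒜 deg u) (a : A) :
    a ∈ Submodule.span ℂ (Set.range fun K : List ι => (K.map u).prod) := by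
  refine hp.induction (P := fun a => a ∈ Submodule.span ℂ _) ?_ ?_ ?_ ?_ ?_ a
  · exact Submodule.subset_span ⟨[], rfl⟩
  · exact fun i => Submodule.subset_span ⟨[i], by simp⟩
  · intro a b ha hb
    have := Submodule.mul_mem_mul ha hb
    rw [Submodule.span_mul_span] at this
    refine Submodule.span_mono ?_ this
    rintro _ ⟨_, ⟨K, rfl⟩, _, ⟨K', rfl⟩, rfl⟩
    exact ⟨K ++ K', by simp⟩
  · exact fun a b => Submodule.add_mem _
  · exact fun r a => Submodule.smul_mem _ r

variable [GradedAlgebra 𝒜]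

theorem prod_mem (hp : IsPolynomialOn 𝒜 deg u) (K : List ι) :
    (K.map u).prod ∈ 𝒜 (K.map fun i => (deg i : ℤ)).sum := by
  induction K with
  | nil => exact SetLike.one_mem_graded 𝒜
  | cons i K ih => exact SetLike.mul_mem_graded (hp.mem i) ih

/-- A homogeneous element is a linear combination of products of generators of its degree. -/
theorem mem_span_of_mem (hp : IsPolynomialOn 𝒜 deg u) {d : ℤ} {a : A} (ha : a ∈ 𝒜 d) :
    a ∈ Submodule.span ℂ {x | ∃ K : List ι, (K.map fun i => (deg i : ℤ)).sum = d ∧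
      (K.map u).prod = x} := by
  -- The projection to degree d sends each product of generators to itself or to zero.
  have : ∀ b : A, (DirectSum.decompose 𝒜 b d : A) ∈ Submodule.span ℂ
      {x | ∃ K : List ι, (K.map fun i => (deg i : ℤ)).sum = d ∧ (K.map u).prod = x} := by
    intro b
    induction hp.mem_span_prod b using Submodule.span_induction with
    | mem x hx =>
      obtain ⟨K, rfl⟩ := hx
      by_cases h : (K.map fun i => (deg i : ℤ)).sum = d
      · have hK := hp.prod_mem K
        rw [h] at hK
        change ((DirectSum.decompose 𝒜 (K.map u).prod) d : A) ∈ _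
        rw [DirectSum.decompose_of_mem_same 𝒜 hK]
        exact Submodule.subset_span ⟨K, h, rfl⟩
      · change ((DirectSum.decompose 𝒜 (K.map u).prod) d : A) ∈ _
        rw [DirectSum.decompose_of_mem_ne 𝒜 (hp.prod_mem K) h]
        exact Submodule.zero_mem _
    | zero => simp
    | add x y _ _ hx hy =>
      rw [DirectSum.decompose_add, DirectSum.add_apply, Submodule.coe_add]
      exact Submodule.add_mem _ hx hy
    | smul r x _ hx =>
      rw [DirectSum.decompose_smul, DirectSum.smul_apply, Submodule.coe_smul]
      exact Submodule.smul_mem _ r hx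
  simpa [DirectSum.decompose_of_mem_same 𝒜 ha] using this a

theorem homog_induction (hp : IsPolynomialOn 𝒜 deg u) {d : ℤ} {P : A → Prop} (zero : P 0)
    (prod : ∀ K : List ι, (K.map fun i => (deg i : ℤ)).sum = d → P (K.map u).prod)
    (lin : ∀ (r : ℂ) (a b : A), a ∈ 𝒜 d → b ∈ 𝒜 d → P a → P b → P (r • a + b)) {a : A}
    (ha : a ∈ 𝒜 d) : P a := by
  have hS : ∀ x ∈ Submodule.span ℂ {x | ∃ K : List ι, (K.map fun i => (deg i : ℤ)).sum = d ∧
      (K.map u).prod = x}, x ∈ 𝒜 d ∧ P x := by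
    intro x hx
    induction hx using Submodule.span_induction with
    | mem x hx =>
      obtain ⟨K, hK, rfl⟩ := hx
      exact ⟨hK ▸ hp.prod_mem K, prod K hK⟩
    | zero => exact ⟨Submodule.zero_mem _, zero⟩
    | add x y _ _ hx hy =>
      refine ⟨Submodule.add_mem _ hx.1 hy.1, ?_⟩
      have := lin 1 x y hx.1 hy.1 hx.2 hy.2
      rwa [one_smul] at this
    | smul r x _ hx =>
      refine ⟨Submodule.smul_mem _ r hx.1, ?_⟩
      have := lin r x 0 hx.1 (Submodule.zero_mem _) hx.2 zero
      rwa [add_zero] at this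
  exact (hS a (hp.mem_span_of_mem ha)).2

theorem eq_zero_of_neg (hp : IsPolynomialOn 𝒜 deg u) {d : ℤ} (hd : d < 0) {a : A}
    (ha : a ∈ 𝒜 d) : a = 0 := by
  refine hp.homog_induction (P := fun a => a = 0) rfl (fun K hK => ?_)
    (fun r a b _ _ ha hb => by rw [ha, hb, smul_zero, add_zero]) ha
  have : 0 ≤ (K.map fun i => (deg i : ℤ)).sum := by
    refine List.sum_nonneg fun x hx => ?_
    obtain ⟨i, -, rfl⟩ := List.mem_map.1 hx
    positivity
  omega

end IsPolynomialOn

/-- The partial derivatives of a free graded commutative algebra, and the automorphisms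
`a ↦ (-1)^{n|a|} a`. -/
structure PartialDerivatives (𝒜 : ℤ → Submodule ℂ A) (deg : ι → ℕ) (u : ι → A) where
  d : A →ₗ[ℂ] (ι →₀ A)
  twist : ℤ → A →ₗ[ℂ] A
  d_gen : ∀ i, d (u i) = Finsupp.single i 1
  d_mem : ∀ p a, a ∈ 𝒜 p → ∀ k, d a k ∈ 𝒜 (p - deg k)
  d_mul : ∀ p a b, a ∈ 𝒜 p → ∀ k,
    d (a * b) k = d a k * b + ((deg k : ℤ) * p).negOnePow • (a * d b k)
  twist_apply : ∀ n p a, a ∈ 𝒜 p → twist n a = (n * p).negOnePow • a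

variable [GradedAlgebra 𝒜]

/-- The generators rescaled by their signs satisfy the same commutation relations, so the universal
property applies. -/
theorem IsPolynomialOn.exists_twist (hp : IsPolynomialOn 𝒜 deg u)
    (hc : ∀ p q a b, a ∈ 𝒜 p → b ∈ 𝒜 q → a * b = (p * q).negOnePow • (b * a)) (n : ℤ) :
    ∃ φ : A →ₐ[ℂ] A, ∀ p a, a ∈ 𝒜 p → φ a = (n * p).negOnePow • a := by
  obtain ⟨φ, hφ⟩ := hp.exists_algHom (fun i => (n * deg i).negOnePow • u i) (fun i j => by
    rw [smul_mul_smul_comm, smul_mul_smul_comm, hc _ _ _ _ (hp.mem i) (hp.mem j), smul_smul,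
      smul_smul, mul_comm, mul_comm (n * (deg i : ℤ)).negOnePow])
  refine ⟨φ, fun p a ha => ?_⟩
  refine hp.homog_induction (P := fun a => φ a = (n * p).negOnePow • a) (by simp) ?_ ?_ ha
  · rintro K rfl
    clear ha
    induction K with
    | nil => simp
    | cons i K ih =>
      simp only [List.map_cons, List.prod_cons, List.sum_cons, map_mul, hφ, ih]
      rw [smul_mul_smul_comm, mul_add, Int.negOnePow_add]
  · intro r a b _ _ ha hb
    rw [map_add, map_smul, ha, hb, smul_add, smul_comm]

-- A twisted derivation is the corner entry of an algebra map into upper triangular matrices, a ↦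
-- (±a, D a; 0, a), and the universal property yields such a map as soon as the images of the
-- generators commute in the graded sense. The clause on products with D a = D b = 0 needs no
-- homogeneity; it later gives the finiteness of the set of nonzero partial derivatives.
open Classical in
theorem IsPolynomialOn.exists_partial (hp : IsPolynomialOn 𝒜 deg u)
    (hc : ∀ p q a b, a ∈ 𝒜 p → b ∈ 𝒜 q → a * b = (p * q).negOnePow • (b * a)) (k : ι) :
    ∃ D : A →ₗ[ℂ] A, (∀ i, D (u i) = if i = k then 1 else 0) ∧
      (∀ a b, D a = 0 → D b = 0 → D (a * b) = 0) ∧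
      (∀ p a, a ∈ 𝒜 p → D a ∈ 𝒜 (p - deg k)) ∧
      ∀ p a b, a ∈ 𝒜 p → D (a * b) = D a * b + ((deg k : ℤ) * p).negOnePow • (a * D b) := by
  set c : ι → A := fun i => if i = k then 1 else 0 with hcdef
  obtain ⟨Φ, hΦ⟩ := hp.exists_algHom
    (fun i => (!![((deg k : ℤ) * deg i).negOnePow • u i, c i; 0, u i] : Matrix (Fin 2) (Fin 2) A))
    (fun i j => by
      have hij := hc _ _ _ _ (hp.mem i) (hp.mem j)
      ext a b
      fin_cases a <;> fin_cases b
      · simp only [Fin.zero_eta, Matrix.mul_apply, Matrix.of_apply, Matrix.cons_val', Matrix.cons_val_zero,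
          Matrix.cons_val_fin_one, Fin.sum_univ_two, Matrix.cons_val_one, Matrix.smul_apply,
          smul_mul_smul_comm, mul_zero, add_zero, hij, smul_smul]
        rw [mul_comm, mul_comm (((deg k : ℤ) * deg i).negOnePow)]
      -- The off-diagonal entry is the only one where the relations are not inherited from the
      -- generators; each case is settled by whether i and j equal k.
      · have h : ((deg k : ℤ) * deg i).negOnePow • (u i * c j) + c i * u j =
            ((deg i : ℤ) * deg j).negOnePow •
              (((deg k : ℤ) * deg j).negOnePow • (u j * c i) + c j * u i) := by
          simp only [hcdef]
          by_cases hi : i = k <;> by_cases hj : j = k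
          · subst hi; subst hj
            simp [smul_add, smul_smul, add_comm]
          · subst hi
            simp [hj, smul_smul]
          · subst hj
            simp [hi, mul_comm]
          · simp [hi, hj]
        simpa [Matrix.mul_apply, smul_mul_assoc] using h
      · simp [Matrix.mul_apply]
      · simp [Matrix.mul_apply, hij])
  have h10 : ∀ a, Φ a 1 0 = 0 := by
    refine hp.induction ?_ ?_ ?_ ?_ ?_
    · simp
    · simp [hΦ]
    · intro a b ha hb
      simp [Matrix.mul_apply, ha, hb]
    · intro a b ha hb
      simp [ha, hb]
    · intro r a ha
      simp [ha]
  have h11 : ∀ a, Φ a 1 1 = a := by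
    refine hp.induction ?_ ?_ ?_ ?_ ?_
    · simp
    · simp [hΦ]
    · intro a b ha hb
      simp [Matrix.mul_apply, ha, hb, h10]
    · intro a b ha hb
      simp [ha, hb]
    · intro r a ha
      simp [ha]
  have h00 : ∀ p a, a ∈ 𝒜 p → Φ a 0 0 = ((deg k : ℤ) * p).negOnePow • a := by
    intro p a ha
    refine hp.homog_induction (P := fun a => Φ a 0 0 = ((deg k : ℤ) * p).negOnePow • a) (by simp)
      ?_ ?_ ha
    · rintro K rfl
      clear ha
      induction K with
      | nil => simp
      | cons i K ih =>
        simp only [List.map_cons, List.prod_cons, List.sum_cons, map_mul, hΦ, Matrix.mul_apply,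
          Fin.sum_univ_two, ih, h10]
        simp [mul_add, Int.negOnePow_add, smul_mul_smul_comm]
    · intro r a b _ _ ha hb
      simp [ha, hb, smul_comm r]
  have hmul : ∀ a b, Φ (a * b) 0 1 = Φ a 0 0 * Φ b 0 1 + Φ a 0 1 * b := by
    intro a b
    simp [Matrix.mul_apply, h11]
  refine ⟨{ toFun := fun a => Φ a 0 1, map_add' := by simp, map_smul' := by simp }, ?_, ?_, ?_, ?_⟩
  · intro i
    simp [hΦ, hcdef]
  · intro a b ha hb
    simp only [LinearMap.coe_mk, AddHom.coe_mk] at *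
    rw [hmul, ha, hb, mul_zero, zero_mul, add_zero]
  · intro p a ha
    refine hp.homog_induction (P := fun a => Φ a 0 1 ∈ 𝒜 (p - deg k)) (by simp) ?_ ?_ ha
    · rintro K rfl
      clear ha
      induction K with
      | nil => simp
      | cons i K ih =>
        simp only [List.map_cons, List.prod_cons, List.sum_cons]
        rw [hmul, h00 _ _ (hp.mem i), Units.smul_def, smul_mul_assoc]
        refine add_mem (zsmul_mem ?_ _) ?_
        · rw [add_sub_assoc]
          exact SetLike.mul_mem_graded (hp.mem i) ih
        · simp only [hΦ, hcdef]
          by_cases h : i = k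
          · simp [h]
            exact hp.prod_mem K
          · simp [h]
    · intro r a b _ _ ha hb
      rw [map_add, map_smul, Matrix.add_apply, Matrix.smul_apply]
      exact Submodule.add_mem _ (Submodule.smul_mem _ r ha) hb
  · intro p a b ha
    simp only [LinearMap.coe_mk, AddHom.coe_mk]
    rw [hmul, h00 p a ha, smul_mul_assoc, add_comm]

open Classical in
theorem IsPolynomialOn.nonempty_partialDerivatives (hp : IsPolynomialOn 𝒜 deg u)
    (hc : ∀ p q a b, a ∈ 𝒜 p → b ∈ 𝒜 q → a * b = (p * q).negOnePow • (b * a)) :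
    Nonempty (PartialDerivatives 𝒜 deg u) := by
  choose tw htw using hp.exists_twist hc
  choose D hgen hzero hmem hmul using hp.exists_partial hc
  have hone : ∀ k, D k 1 = 0 := by
    intro k
    have := hmul k 0 1 1 (SetLike.one_mem_graded 𝒜)
    simpa using this
  have hfin : ∀ a, (Function.support fun k => D k a).Finite := by
    refine hp.induction ?_ ?_ ?_ ?_ ?_
    · simp [hone]
    · intro i
      refine (Set.finite_singleton i).subset fun k hk => ?_
      by_contra h
      exact hk (by simp only [hgen]; exact if_neg fun e => h e.symm)
    · intro a b ha hb
      refine (ha.union hb).subset fun k hk => ?_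
      by_contra h
      simp only [Set.mem_union, Function.mem_support, not_or, not_not] at h
      exact hk (hzero k a b h.1 h.2)
    · intro a b ha hb
      refine (ha.union hb).subset fun k hk => ?_
      by_contra h
      simp only [Set.mem_union, Function.mem_support, not_or, not_not] at h
      exact hk (by simp only [map_add, h.1, h.2, add_zero])
    · intro r a ha
      refine ha.subset fun k hk => ?_
      by_contra h
      simp only [Function.mem_support, not_not] at h
      exact hk (by simp only [map_smul, h, smul_zero])
  refine ⟨{ d := { toFun := fun a => Finsupp.ofSupportFinite (fun k => D k a) (hfin a)
                   map_add' := fun a b => ?_, map_smul' := fun r a => ?_ }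
            twist := fun n => (tw n).toLinearMap
            d_gen := fun i => ?_
            d_mem := fun p a ha k => hmem k p a ha
            d_mul := fun p a b ha k => hmul k p a b ha
            twist_apply := htw }⟩
  · ext k
    exact map_add (D k) a b
  · ext k
    exact map_smul (D k) r a
  · ext k
    change D k (u i) = _
    rw [hgen, Finsupp.single_apply]

end Polynomial
-- Multivectors with prescribed values on generators.
section Contraction

variable {A : Type*} [Ring A] [Algebra ℂ A] {𝒜 : ℤ → Submodule ℂ A}
  {ι : Type*} {deg : ι → ℕ} {u : ι → A}

theorem negOnePow_smul_mem {p : ℤ} (n : ℤ) {a : A} (ha : a ∈ 𝒜 p) : n.negOnePow • a ∈ 𝒜 p := by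
  rw [Units.smul_def]
  exact zsmul_mem ha _

/-- The degree of the symbol `du` of a generator `u`. -/
def genWt (deg : ι → ℕ) (i : ι) : ℤ := (deg i : ℤ) + 1

/-- A graded antisymmetric family of values, of upper degree `m`, on lists of generators. -/
structure IsSymbol (𝒜 : ℤ → Submodule ℂ A) (deg : ι → ℕ) (m : ℤ) (c : List ι → A) : Prop where
  mem : ∀ K, c K ∈ 𝒜 (weight (genWt deg) K - m)
  anti : ∀ K i j K', c (K ++ j :: i :: K') =
    (genWt deg i * genWt deg j).negOnePow • c (K ++ i :: j :: K')

theorem IsSymbol.cons {m : ℤ} {c : List ι → A} (hc : IsSymbol 𝒜 deg m c) (i : ι) :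
    IsSymbol 𝒜 deg (m - deg i - 1) (fun K => c (i :: K)) where
  mem K := by
    convert hc.mem (i :: K) using 2
    rw [weight_cons, genWt]
    ring
  anti K j k K' := hc.anti (i :: K) j k K'

namespace PartialDerivatives

variable (D : PartialDerivatives 𝒜 deg u)

/-- The multiderivation of upper degree `m` with given values on the generators. -/
noncomputable def contract : List A → ℤ → (List ι → A) → A
  | [], _, c => c []
  -- With df = ∑ duᵢ · ∂ᵢf, the twist is the sign of carrying ∂ᵢf to the left across duᵢ and a
  -- multivector of upper degree m. Once duᵢ is consumed, the remaining multivector has upper degree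
  -- m - |uᵢ| - 1.
  | f :: L, m, c => (D.d f).sum fun i x =>
      D.twist (m + deg i + 1) x * contract L (m - deg i - 1) (fun K => c (i :: K))

theorem contract_cons_eq (f : A) (L : List A) (m : ℤ) (c : List ι → A) {S : Finset ι}
    (hS : (D.d f).support ⊆ S) : D.contract (f :: L) m c = ∑ i ∈ S,
      D.twist (m + deg i + 1) (D.d f i) *
        D.contract L (m - deg i - 1) (fun K => c (i :: K)) := by
  rw [contract, Finsupp.sum_of_support_subset _ hS]
  simp

theorem contract_gen [GradedAlgebra 𝒜] (K : List ι) (m : ℤ) (c : List ι → A) :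
    D.contract (K.map u) m c = c K := by
  induction K generalizing m c with
  | nil => rfl
  | cons i K ih =>
    rw [List.map_cons, contract, D.d_gen, Finsupp.sum_single_index (by simp), ih,
      D.twist_apply _ 0 1 (SetLike.one_mem_graded 𝒜)]
    simp

theorem contract_smul (L : List A) (m a : ℤ) (c : List ι → A) :
    D.contract L m (fun K => a.negOnePow • c K) = a.negOnePow • D.contract L m c := by
  induction L generalizing m c with
  | nil => rfl
  | cons f L ih => simp only [contract, ih, mul_smul_comm, Finsupp.smul_sum]

theorem contract_lin (L L' : List A) (m : ℤ) (c : List ι → A) (r : ℂ) (x y : A) :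
    D.contract (L ++ (r • x + y) :: L') m c =
      r • D.contract (L ++ x :: L') m c + D.contract (L ++ y :: L') m c := by
  induction L generalizing m c with
  | nil =>
    have h : ∀ f, D.contract (f :: L') m c = Finsupp.lsum ℂ (fun i =>
        (LinearMap.mulRight ℂ (D.contract L' (m - deg i - 1) (fun K => c (i :: K)))).comp
          (D.twist (m + deg i + 1))) (D.d f) := fun f => rfl
    simp only [List.nil_append, h, map_add, map_smul]
  | cons f L ih =>
    simp only [List.cons_append, contract, ih, mul_add, mul_smul_comm]
    rw [Finsupp.sum_add, Finsupp.smul_sum]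

theorem twist_mem {n p : ℤ} {a : A} (ha : a ∈ 𝒜 p) : D.twist n a ∈ 𝒜 p := by
  rw [D.twist_apply n p a ha]
  exact negOnePow_smul_mem _ ha

/-- When the two entries head the list, exchanging the summations over their partial derivatives
reduces the claim to antisymmetry of the symbol and to graded commutativity of the derivatives. -/
theorem contract_anti
    (hcomm : ∀ p q a b, a ∈ 𝒜 p → b ∈ 𝒜 q → a * b = (p * q).negOnePow • (b * a))
    {m : ℤ} {c : List ι → A} (hc : IsSymbol 𝒜 deg m c) (L : List (Homog 𝒜)) (x y : Homog 𝒜)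
    (L' : List (Homog 𝒜)) : D.contract ((L ++ y :: x :: L').map Homog.val) m c =
      (x.wt * y.wt).negOnePow • D.contract ((L ++ x :: y :: L').map Homog.val) m c := by
  induction L generalizing m c with
  | nil =>
    simp only [List.nil_append, List.map_cons, contract]
    simp only [Finsupp.sum, Finset.mul_sum, Finset.smul_sum]
    rw [Finset.sum_comm]
    refine Finset.sum_congr rfl fun i _ => Finset.sum_congr rfl fun j _ => ?_
    have hdx := D.d_mem _ _ x.mem i
    have hdy := D.d_mem _ _ y.mem j
    have hcs : (fun K => c (j :: i :: K)) = fun K =>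
        (genWt deg i * genWt deg j).negOnePow • c (i :: j :: K) := by
      funext K
      exact hc.anti [] i j K
    rw [show m - (deg j : ℤ) - 1 - deg i - 1 = m - (deg i : ℤ) - 1 - deg j - 1 by ring, hcs]
    rw [contract_smul, D.twist_apply _ _ _ hdx, D.twist_apply _ _ _ hdx, D.twist_apply _ _ _ hdy,
      D.twist_apply _ _ _ hdy]
    simp only [smul_mul_assoc, mul_smul_comm, smul_smul, ← mul_assoc, ← Int.negOnePow_add]
    rw [hcomm _ _ _ _ hdy hdx]
    simp only [smul_mul_assoc, smul_smul, ← Int.negOnePow_add]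
    refine negOnePow_smul_congr_zmod ?_ _
    simp only [Homog.wt, genWt]
    push_cast
    have := zmod_two_mul_self (deg i : ZMod 2)
    have := zmod_two_mul_self (deg j : ZMod 2)
    grind
  | cons f L ih =>
    simp only [List.cons_append, List.map_cons, contract]
    rw [Finsupp.smul_sum]
    refine Finsupp.sum_congr fun i _ => ?_
    rw [ih (hc.cons i), mul_smul_comm]

variable [GradedAlgebra 𝒜]

theorem contract_mem (L : List (Homog 𝒜)) {m : ℤ} {c : List ι → A} (hc : IsSymbol 𝒜 deg m c) :
    D.contract (L.map Homog.val) m c ∈ 𝒜 (weight Homog.wt L - m) := by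
  induction L generalizing m c with
  | nil => exact hc.mem []
  | cons f L ih =>
    rw [List.map_cons, contract]
    refine sum_mem fun i _ => ?_
    have := SetLike.mul_mem_graded (D.twist_mem (n := m + deg i + 1) (D.d_mem _ _ f.mem i))
      (ih (hc.cons i))
    convert this using 2
    rw [weight_cons, Homog.wt]
    ring

theorem contract_leib (hcomm : ∀ p q a b, a ∈ 𝒜 p → b ∈ 𝒜 q → a * b = (p * q).negOnePow • (b * a))
    {m : ℤ} {c : List ι → A} (hc : IsSymbol 𝒜 deg m c) (x y : Homog 𝒜) (L : List (Homog 𝒜)) :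
    D.contract ((x.val * y.val) :: L.map Homog.val) m c =
      (y.deg * weight Homog.wt L).negOnePow • (D.contract (x.val :: L.map Homog.val) m c * y.val) +
      (x.deg * (1 + m)).negOnePow • (x.val * D.contract (y.val :: L.map Homog.val) m c) := by
  classical
  -- A common index set for the three sums, so that they can be compared termwise.
  set S := (D.d (x.val * y.val)).support ∪ ((D.d x.val).support ∪ (D.d y.val).support) with hS
  rw [D.contract_cons_eq (x.val * y.val) _ m c (S := S) Finset.subset_union_left,
    D.contract_cons_eq x.val _ m c (S := S)
      (Finset.subset_union_left.trans Finset.subset_union_right),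
    D.contract_cons_eq y.val _ m c (S := S)
      (Finset.subset_union_right.trans Finset.subset_union_right),
    Finset.sum_mul, Finset.mul_sum, Finset.smul_sum, Finset.smul_sum, ← Finset.sum_add_distrib]
  refine Finset.sum_congr rfl fun i _ => ?_
  have hE := D.contract_mem L (hc.cons i)
  set E := D.contract (L.map Homog.val) (m - deg i - 1) (fun K => c (i :: K))
  have hdx := D.d_mem _ _ x.mem i
  have hdy := D.d_mem _ _ y.mem i
  have h₁ := SetLike.mul_mem_graded hdx y.mem
  have h₂ := SetLike.mul_mem_graded x.mem hdy
  rw [D.d_mul _ _ _ x.mem, map_add, D.twist_apply _ _ _ h₁,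
    D.twist_apply _ _ _ (negOnePow_smul_mem _ h₂),
    D.twist_apply _ _ _ hdx, D.twist_apply _ _ _ hdy]
  simp only [add_mul, smul_mul_assoc, mul_smul_comm, smul_smul, mul_assoc, ← Int.negOnePow_add]
  rw [hcomm _ _ _ _ y.mem hE]
  simp only [mul_smul_comm, smul_smul, ← Int.negOnePow_add]
  congr 1 <;> refine negOnePow_smul_congr_zmod ?_ _ <;> push_cast <;> grind

/-- The multivector with given values on lists of generators. -/
noncomputable def multivector
    (hcomm : ∀ p q a b, a ∈ 𝒜 p → b ∈ 𝒜 q → a * b = (p * q).negOnePow • (b * a))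
    {m : ℤ} (c : List ι → A) (hc : IsSymbol 𝒜 deg m c) : HomogMultivector 𝒜 m where
  toFun L := D.contract (L.map Homog.val) m c
  mem L := D.contract_mem L hc
  lin L L' r x y z _ _ h := by
    simp only [List.map_append, List.map_cons]
    rw [h, D.contract_lin]
  anti L x y L' := D.contract_anti hcomm hc L x y L'
  leib x y z L _ h := by
    simp only [List.map_cons]
    rw [h, D.contract_leib hcomm hc]

end PartialDerivatives

/-- A generator, as a homogeneous element. -/
def IsPolynomialOn.gen (hp : IsPolynomialOn 𝒜 deg u) (i : ι) : Homog 𝒜 := ⟨deg i, u i, hp.mem i⟩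

theorem IsPolynomialOn.weight_gen (hp : IsPolynomialOn 𝒜 deg u) (K : List ι) :
    weight Homog.wt (K.map hp.gen) = weight (genWt deg) K := by
  induction K with
  | nil => rfl
  | cons i K ih => rw [List.map_cons, weight_cons, ih, weight_cons]; rfl

theorem HomogMultivector.map_one {m : ℤ} (F : HomogMultivector 𝒜 m) (L L' : List (Homog 𝒜))
    (x : Homog 𝒜) (hx : x.deg = 0) (h : x.val = 1) : F.toFun (L ++ x :: L') = 0 := by
  -- The Leibniz rule for 1 = 1 · 1.
  have := F.leib_at L L' x x x (by simp [hx]) (by simp [h])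
  simpa [hx, h] using this

variable [GradedAlgebra 𝒜]

/-- Two multivectors that agree on the lists of generators of weight at most `N` agree on all
lists of homogeneous elements of weight at most `N`. -/
theorem IsPolynomialOn.ext_of_weight_le (hp : IsPolynomialOn 𝒜 deg u) {m N : ℤ}
    {F G : HomogMultivector 𝒜 m}
    (h : ∀ K : List ι, weight (genWt deg) K ≤ N → F.toFun (K.map hp.gen) = G.toFun (K.map hp.gen))
    (L : List (Homog 𝒜)) (hL : weight Homog.wt L ≤ N) : F.toFun L = G.toFun L := by
  -- Entries are reduced to generators from the right end; K collects those already treated.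
  suffices key : ∀ (L : List (Homog 𝒜)) (K : List ι),
      weight Homog.wt L + weight (genWt deg) K ≤ N →
      F.toFun (L ++ K.map hp.gen) = G.toFun (L ++ K.map hp.gen) by
    simpa using key L [] (by simpa using hL)
  intro L
  clear hL
  induction L using List.reverseRecOn with
  | nil =>
    intro K hK
    exact h K (by simpa using hK)
  | append_singleton L x ih =>
    intro K hK
    simp only [List.append_assoc, List.singleton_append]
    have hP : ∀ (a : A), a ∈ 𝒜 x.deg → ∀ ha : a ∈ 𝒜 x.deg,
        F.toFun (L ++ ⟨x.deg, a, ha⟩ :: K.map hp.gen) =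
          G.toFun (L ++ ⟨x.deg, a, ha⟩ :: K.map hp.gen) := by
      intro a ha
      refine hp.homog_induction (d := x.deg) (P := fun a => ∀ ha : a ∈ 𝒜 x.deg,
        F.toFun (L ++ ⟨x.deg, a, ha⟩ :: K.map hp.gen) =
          G.toFun (L ++ ⟨x.deg, a, ha⟩ :: K.map hp.gen)) ?_ ?_ ?_ ha
      · intro _
        rw [F.map_zero _ _ rfl, G.map_zero _ _ rfl]
      · intro M hM hmem
        have hw : weight Homog.wt L + ((M.map fun i => (deg i : ℤ)).sum + 1) +
            weight (genWt deg) K ≤ N := by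
          rw [hM]
          simpa [Homog.wt, add_assoc] using hK
        -- The Leibniz rule splits off one generator at a time. Neither resulting list is heavier,
        -- because generators have degree at least 0.
        have main : ∀ (M : List ι) (z : Homog 𝒜), z.deg = (M.map fun i => (deg i : ℤ)).sum →
            z.val = (M.map u).prod → weight Homog.wt L + ((M.map fun i => (deg i : ℤ)).sum + 1) +
              weight (genWt deg) K ≤ N →
            F.toFun (L ++ z :: K.map hp.gen) = G.toFun (L ++ z :: K.map hp.gen) := by
          intro M
          induction M with
          | nil =>
            intro z hz hz' _
            rw [F.map_one _ _ z hz hz', G.map_one _ _ z hz hz']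
          | cons i M ihM =>
            intro z hz hz' hM
            rw [List.map_cons, List.sum_cons] at hM
            have hnn : 0 ≤ (M.map fun i => (deg i : ℤ)).sum := by
              refine List.sum_nonneg fun x hx => ?_
              obtain ⟨i, -, rfl⟩ := List.mem_map.1 hx
              positivity
            have hnn' : (0 : ℤ) ≤ deg i := by positivity
            have e₁ := ih (i :: K) (by rw [weight_cons, genWt]; linarith)
            have e₂ := ihM ⟨_, _, hp.prod_mem M⟩ rfl rfl (by linarith)
            rw [List.map_cons] at e₁
            rw [F.leib_at L _ (hp.gen i) ⟨_, _, hp.prod_mem M⟩ z hz hz',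
              G.leib_at L _ (hp.gen i) ⟨_, _, hp.prod_mem M⟩ z hz hz', e₁, e₂]
        exact main M _ hM.symm rfl hw
      · intro r a b ha hb iha ihb hab
        rw [F.lin L _ r ⟨x.deg, a, ha⟩ ⟨x.deg, b, hb⟩ ⟨x.deg, _, hab⟩ rfl rfl rfl,
          G.lin L _ r ⟨x.deg, a, ha⟩ ⟨x.deg, b, hb⟩ ⟨x.deg, _, hab⟩ rfl rfl rfl, iha ha, ihb hb]
    exact hP x.val x.mem x.mem

end Contraction
-- The square in lowest weight: dependence on the values and the obstruction.
theorem unsh_eq_of_nil {α M : Type*} [AddCommGroup M] {w : α → ℤ} {L : List α}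
    {G : List α → List α → M} (h : ∀ I J, I ≠ [] → (I ++ J).Perm L → G I J = 0) :
    unsh w L G = G [] L := by
  induction L generalizing G with
  | nil => rfl
  | cons x L ih =>
    rw [unsh, ih]
    · simp [h [x] L (by simp) (List.Perm.refl _)]
    · intro I J hI hIJ
      rw [h (x :: I) J (by simp) (hIJ.cons x),
        h I (x :: J) hI (List.perm_middle.trans (hIJ.cons x)), smul_zero, add_zero]

/-- A nonempty list of such symbols has positive weight; this makes the induction on weight
triangular. -/
theorem le_weight_of_one_le {α : Type*} {w : α → ℤ} {L : List α} (h : ∀ x ∈ L, 1 ≤ w x) :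
    (L.length : ℤ) ≤ weight w L := by
  induction L with
  | nil => simp
  | cons x L ih =>
    have h₁ := h x List.mem_cons_self
    have h₂ := ih fun y hy => h y (List.mem_cons_of_mem x hy)
    rw [weight_cons, List.length_cons]
    push_cast
    linarith

section Multivectors

variable {A : Type*} [Ring A] [Algebra ℂ A] {𝒜 : ℤ → Submodule ℂ A}
  {ι : Type*} {deg : ι → ℕ} {u : ι → A}

/-- The zero multivector. -/
instance {m : ℤ} : Zero (HomogMultivector 𝒜 m) where
  zero :=
    { toFun := fun _ => 0
      mem := fun _ => Submodule.zero_mem _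
      lin := by intros; simp
      anti := by intros; simp
      leib := by intros; simp }

theorem HomogMultivector.weight_append_app (F : HomogMultivector 𝒜 2) (I J : List (Homog 𝒜)) :
    weight Homog.wt (I ++ [F.app J]) = weight Homog.wt I + weight Homog.wt J - 1 := by
  simp only [weight_append, weight_cons, weight_nil, Homog.wt, app]
  ring

/-- The inner list is no heavier than L, and the outer list has weight one less than L. -/
theorem HomogMultivector.squareEval_congr {F G : HomogMultivector 𝒜 2} {N : ℤ}
    (h : ∀ L, weight Homog.wt L ≤ N → F.toFun L = G.toFun L) {L : List (Homog 𝒜)}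
    (hpos : ∀ x ∈ L, 1 ≤ x.wt) (hL : weight Homog.wt L ≤ N) :
    F.squareEval L = G.squareEval L := by
  refine unsh_congr fun I J hIJ => ?_
  have hw := weight_perm Homog.wt hIJ
  rw [weight_append] at hw
  have hI := le_weight_of_one_le (w := Homog.wt) (L := I) fun x hx =>
    hpos x (hIJ.subset (List.mem_append_left J hx))
  have hJ : F.app J = G.app J := by
    ext
    · rfl
    · exact h J (by omega)
  rw [squareTerm, squareTerm, hJ, h]
  rw [weight_append_app]
  omega

/-- The effect on the square of a modification of top weight. -/
theorem HomogMultivector.squareEval_sub {F G : HomogMultivector 𝒜 2} {N : ℤ}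
    (h : ∀ L, weight Homog.wt L ≤ N → F.toFun L = G.toFun L) {L : List (Homog 𝒜)}
    (hpos : ∀ x ∈ L, 1 ≤ x.wt) (hL : weight Homog.wt L = N + 1) :
    F.squareEval L - G.squareEval L = G.toFun [F.app L] - G.toFun [G.app L] := by
  rw [squareEval, squareEval, sub_eq_add_neg, ← unsh_neg, ← unsh_add, unsh_eq_of_nil]
  · rw [squareTerm, squareTerm, h]
    · simp [sub_eq_add_neg]
    · rw [weight_append_app, hL, weight_nil]
      omega
  · intro I J hI hIJ
    have hw := weight_perm Homog.wt hIJ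
    rw [weight_append] at hw
    have hI' := le_weight_of_one_le (w := Homog.wt) (L := I) fun x hx =>
      hpos x (hIJ.subset (List.mem_append_left J hx))
    have := List.length_pos_of_ne_nil hI
    have hJ : F.app J = G.app J := by
      ext
      · rfl
      · exact h J (by omega)
    rw [squareTerm, squareTerm, hJ, h, add_neg_cancel]
    rw [weight_append_app]
    omega

theorem IsPolynomialOn.one_le_wt_of_mem (hp : IsPolynomialOn 𝒜 deg u) (K : List ι) :
    ∀ x ∈ K.map hp.gen, 1 ≤ x.wt := by
  intro x hx
  obtain ⟨i, -, rfl⟩ := List.mem_map.1 hx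
  change 1 ≤ (deg i : ℤ) + 1
  omega

variable [GradedAlgebra 𝒜]

/-- The Bianchi identity in the lowest weight in which the square does not vanish. -/
theorem HomogMultivector.toFun_square_eq_zero {F : HomogMultivector 𝒜 2} {N : ℤ}
    (h : ∀ L, weight Homog.wt L ≤ N → F.squareEval L = 0) {L : List (Homog 𝒜)}
    (hpos : ∀ x ∈ L, 1 ≤ x.wt) (hL : weight Homog.wt L = N + 1) :
    F.toFun [F.square.app L] = 0 := by
  have key := F.unsh_square_app L
  -- On the left of the Bianchi identity a nonempty I leaves F²(J) in weight at most N, so only I =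
  -- [] survives. On the right every square is taken on a list of weight N.
  rw [unsh_eq_of_nil, unsh_eq_zero] at key
  · exact key
  · intro I J hIJ
    rw [h, smul_zero]
    rw [weight_append_app, ← weight_append, weight_perm _ hIJ]
    omega
  · intro I J hI hIJ
    have hw := weight_perm Homog.wt hIJ
    rw [weight_append] at hw
    have hI' := le_weight_of_one_le (w := Homog.wt) (L := I) fun x hx =>
      hpos x (hIJ.subset (List.mem_append_left J hx))
    have := List.length_pos_of_ne_nil hI
    exact F.map_zero I [] (h J (by omega))

theorem IsPolynomialOn.deg_zero_induction (hp : IsPolynomialOn 𝒜 deg u) {P : A → Prop}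
    (zero : P 0) (one : P 1) (gen : ∀ i, deg i = 0 → P (u i))
    (mul : ∀ a b, a ∈ 𝒜 0 → b ∈ 𝒜 0 → P a → P b → P (a * b))
    (lin : ∀ (r : ℂ) (a b : A), a ∈ 𝒜 0 → b ∈ 𝒜 0 → P a → P b → P (r • a + b)) {a : A}
    (ha : a ∈ 𝒜 0) : P a := by
  refine hp.homog_induction zero (fun K hK => ?_) lin ha
  induction K with
  | nil => exact one
  | cons i K ih =>
    have hnn : 0 ≤ (K.map fun i => (deg i : ℤ)).sum := by
      refine List.sum_nonneg fun x hx => ?_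
      obtain ⟨i, -, rfl⟩ := List.mem_map.1 hx
      positivity
    rw [List.map_cons, List.sum_cons] at hK
    have hi : deg i = 0 := by omega
    have hK' : (K.map fun i => (deg i : ℤ)).sum = 0 := by omega
    rw [List.map_cons, List.prod_cons]
    refine mul _ _ ?_ ?_ (gen i hi) (ih hK')
    · simpa [hi] using hp.mem i
    · rw [← hK']
      exact hp.prod_mem K

theorem PartialDerivatives.multivector_gen (D : PartialDerivatives 𝒜 deg u)
    (hp : IsPolynomialOn 𝒜 deg u)
    (hcomm : ∀ p q a b, a ∈ 𝒜 p → b ∈ 𝒜 q → a * b = (p * q).negOnePow • (b * a))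
    {m : ℤ} {c : List ι → A} (hc : IsSymbol 𝒜 deg m c) (K : List ι) :
    (D.multivector hcomm c hc).toFun (K.map hp.gen) = c K := by
  change D.contract ((K.map hp.gen).map Homog.val) m c = c K
  rw [List.map_map]
  exact D.contract_gen K m c

end Multivectors

/-! ### Multivectors extending the differential and lifting the Poisson bracket. -/

section Lift

variable {O : Type*} [CommRing O] [Algebra ℂ O] {br : O →ₗ[ℂ] O →ₗ[ℂ] O}
  {A : Type*} [Ring A] [Algebra ℂ A] {𝒜 : ℤ → Submodule ℂ A} [GradedAlgebra 𝒜]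
  {δ : A →ₗ[ℂ] A} {ι : Type*} {deg : ι → ℕ} {u : ι → A} {ε : A →ₐ[ℂ] O}

/-- A multivector of upper degree `2` whose component of order `1` is the differential and whose
component of order `2` lifts the bracket. -/
structure IsLift (br : O →ₗ[ℂ] O →ₗ[ℂ] O) (δ : A →ₗ[ℂ] A) (ε : A →ₐ[ℂ] O)
    (F : HomogMultivector 𝒜 2) : Prop where
  single : ∀ x, F.toFun [x] = δ x.val
  pair : ∀ x y, ε (F.toFun [x, y]) = br (ε x.val) (ε y.val)

theorem IsPoisson.map_one (hbr : IsPoisson br) (f : O) : br f 1 = 0 := by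
  have := hbr.leibniz f 1 1
  simpa using this

/-- Both sides of each condition satisfy the same Leibniz rules. For pairs only degree 0 generators
matter: an element of negative degree is zero, and ε kills positive degrees. -/
theorem IsLift.of_gen (hbr : IsPoisson br) (hres : IsResolution 𝒜 δ deg u ε)
    {F : HomogMultivector 𝒜 2}
    (single : ∀ i, F.toFun [hres.polynomial.gen i] = δ (u i))
    (pair : ∀ i j, deg i = 0 → deg j = 0 →
      ε (F.toFun [hres.polynomial.gen i, hres.polynomial.gen j]) = br (ε (u i)) (ε (u j))) :
    IsLift br δ ε F where
  single x := by
    have hp := hres.polynomial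
    obtain ⟨d, a, ha⟩ := x
    refine hp.homog_induction (d := d)
      (P := fun a => ∀ ha : a ∈ 𝒜 d, F.toFun [⟨d, a, ha⟩] = δ a) ?_ ?_ ?_ ha ha
    · intro _
      rw [map_zero]
      exact F.map_zero [] [] rfl
    · rintro K rfl hK
      clear ha
      induction K with
      | nil =>
        have h1 : δ 1 = 0 := by
          have := hres.dga.leibniz 0 1 1 (SetLike.one_mem_graded 𝒜)
          simpa using this
        exact (F.map_one [] [] _ rfl rfl).trans h1.symm
      | cons i K ih =>
        have := F.leib (hp.gen i) ⟨_, _, hp.prod_mem K⟩ ⟨_, _, hK⟩ [] rfl rfl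
        rw [this, single, ih (hp.prod_mem K), List.map_cons, List.prod_cons,
          hres.dga.leibniz _ _ _ (hp.mem i)]
        simp only [weight_nil, mul_zero, Int.negOnePow_zero, one_smul]
        congr 1
        refine negOnePow_smul_congr_zmod ?_ _
        change (((deg i : ℤ) * (1 + 2) : ℤ) : ZMod 2) = _
        push_cast
        grind
    · intro r a b ha hb iha ihb hab
      have := F.lin [] [] r ⟨d, a, ha⟩ ⟨d, b, hb⟩ ⟨d, _, hab⟩ rfl rfl rfl
      simp only [List.nil_append] at this
      rw [this, iha ha, ihb hb, map_add, map_smul]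
  pair x y := by
    have hp := hres.polynomial
    have hneg : ∀ z : Homog 𝒜, z.deg < 0 → z.val = 0 := fun z hz => hp.eq_zero_of_neg hz z.mem
    have hq := hres.quasiIso
    have z₁ : ∀ x y : Homog 𝒜, x.val = 0 → F.toFun [x, y] = 0 := fun x y h => F.map_zero [] [y] h
    have z₂ : ∀ x y : Homog 𝒜, y.val = 0 → F.toFun [x, y] = 0 := fun x y h => F.map_zero [x] [] h
    -- F[x, y] has degree |x| + |y|, so outside bidegree (0, 0) both sides vanish.
    rcases lt_trichotomy x.deg 0 with hx | hx | hx
    · rw [hneg x hx, map_zero, map_zero, LinearMap.zero_apply, z₁ x y (hneg x hx), map_zero]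
    · rcases lt_trichotomy y.deg 0 with hy | hy | hy
      · rw [hneg y hy, map_zero, map_zero, z₂ x y (hneg y hy), map_zero]
      · have one : (1 : A) ∈ 𝒜 0 := SetLike.one_mem_graded 𝒜
        have mul : ∀ {a b : A}, a ∈ 𝒜 0 → b ∈ 𝒜 0 → a * b ∈ 𝒜 0 := fun ha hb => by
          simpa using SetLike.mul_mem_graded ha hb
        have wt0 : ∀ (a : A) (ha : a ∈ 𝒜 0), (⟨0, a, ha⟩ : Homog 𝒜).wt = 1 := fun _ _ => rfl
        have step : ∀ i, deg i = 0 → ∀ (a : A) (ha : a ∈ 𝒜 0),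
            ε (F.toFun [⟨0, a, ha⟩, hp.gen i]) = br (ε a) (ε (u i)) := by
          intro i hi a ha
          refine hp.deg_zero_induction (P := fun a => ∀ ha : a ∈ 𝒜 0,
            ε (F.toFun [⟨0, a, ha⟩, hp.gen i]) = br (ε a) (ε (u i))) ?_ ?_ ?_ ?_ ?_ ha ha
          · intro _
            rw [z₁ _ _ rfl]
            simp
          · intro _
            rw [show F.toFun [_, hp.gen i] = 0 from F.map_one [] [hp.gen i] _ rfl rfl, map_zero, map_one, hbr.skew, hbr.map_one,
              neg_zero]
          · intro j hj _
            rw [← pair j i hj hi]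
            congr 3
            ext
            · exact (Nat.cast_eq_zero.2 hj).symm
            · rfl
          · intro a b ha hb iha ihb hab
            rw [F.leib ⟨0, a, ha⟩ ⟨0, b, hb⟩ ⟨0, _, hab⟩ [hp.gen i] rfl rfl]
            simp only [zero_mul, Int.negOnePow_zero, one_smul, map_add, map_mul, iha ha, ihb hb]
            rw [hbr.skew (ε a * ε b), hbr.leibniz, hbr.skew (ε (u i)) (ε a),
              hbr.skew (ε (u i)) (ε b)]
            ring
          · intro r a b ha hb iha ihb hab
            have := F.lin [] [hp.gen i] r ⟨0, a, ha⟩ ⟨0, b, hb⟩ ⟨0, _, hab⟩ rfl rfl rfl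
            simp only [List.nil_append] at this
            rw [this, map_add, map_smul, iha ha, ihb hb]
            simp
        obtain ⟨d, a, ha⟩ := x
        obtain ⟨d', b, hb⟩ := y
        obtain rfl : d = 0 := hx
        obtain rfl : d' = 0 := hy
        refine hp.deg_zero_induction (P := fun b => ∀ hb : b ∈ 𝒜 0,
            ε (F.toFun [⟨0, a, ha⟩, ⟨0, b, hb⟩]) = br (ε a) (ε b)) ?_ ?_ ?_ ?_ ?_ hb hb
        · intro _
          rw [z₂ _ _ rfl]
          simp
        · intro _
          rw [show F.toFun [⟨0, a, ha⟩, _] = 0 from F.map_one [⟨0, a, ha⟩] [] _ rfl rfl, map_zero, map_one, hbr.map_one]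
        · intro j hj _
          rw [← step j hj a ha]
          congr 4
          ext
          · exact (Nat.cast_eq_zero.2 hj).symm
          · rfl
        · intro b b' hb hb' ihb ihb' hbb
          have := F.leib_at [⟨0, a, ha⟩] [] ⟨0, b, hb⟩ ⟨0, b', hb'⟩ ⟨0, _, hbb⟩ rfl rfl
          simp only [List.singleton_append, zero_mul, Int.negOnePow_zero, one_smul] at this
          rw [this, map_add, map_mul, map_mul, ihb hb, ihb' hb', map_mul, hbr.leibniz]
        · intro r b b' hb hb' ihb ihb' hbb
          have := F.lin [⟨0, a, ha⟩] [] r ⟨0, b, hb⟩ ⟨0, b', hb'⟩ ⟨0, _, hbb⟩ rfl rfl rfl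
          simp only [List.singleton_append] at this
          rw [this, map_add, map_smul, ihb hb, ihb' hb']
          simp
      · rw [hq.map_of_ne_zero _ _ hy.ne' y.mem, map_zero]
        refine hq.map_of_ne_zero _ _ ?_ (F.mem [x, y])
        simp only [weight_cons, weight_nil, Homog.wt]
        omega
    · rw [hq.map_of_ne_zero _ _ hx.ne' x.mem, map_zero, LinearMap.zero_apply]
      by_cases hy : y.deg < 0
      · rw [z₂ x y (hneg y hy), map_zero]
      · refine hq.map_of_ne_zero _ _ ?_ (F.mem [x, y])
        simp only [weight_cons, weight_nil, Homog.wt]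
        omega

theorem IsLift.toFun_nil (hres : IsResolution 𝒜 δ deg u ε) (F : HomogMultivector 𝒜 2) :
    F.toFun [] = 0 :=
  hres.polynomial.eq_zero_of_neg (d := weight Homog.wt ([] : List (Homog 𝒜)) - 2) (by simp)
    (F.mem [])

/-- A list of generators of weight 3 has at most three entries. With one or two entries every term
contains a boundary in a place killed by ε or by the bracket after ε, or the zero value F[]. With
three entries all degrees are 0, and what remains is the Jacobiator. -/
theorem IsLift.map_squareEval (hbr : IsPoisson br) (hres : IsResolution 𝒜 δ deg u ε)
    {F : HomogMultivector 𝒜 2} (hF : IsLift br δ ε F) {K : List ι}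
    (hK : weight (genWt deg) K = 3) : ε (F.squareEval (K.map hres.polynomial.gen)) = 0 := by
  have hp := hres.polynomial
  have hpos : ∀ i, 1 ≤ genWt deg i := fun i => by rw [genWt]; omega
  have hsign : ∀ (n : ℤ) (a : A), ε (n.negOnePow • a) = n.negOnePow • ε a := fun n a =>
    map_negOnePow_smul (ε : A →+* O).toAddMonoidHom n a
  have hnil : (F.app []).val = 0 := IsLift.toFun_nil hres F
  have hsingle : ∀ x, (F.app [x]).val = δ x.val := hF.single
  have hlast : ∀ I, F.toFun (I ++ [F.app []]) = 0 := fun I => F.map_zero I [] hnil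
  have htop : ∀ J, ε (F.toFun [F.app J]) = 0 := fun J => by
    rw [hF.single, hres.quasiIso.map_differential]
  have hpair : ∀ x J, ε (F.toFun [x, F.app J]) = br (ε x.val) (ε (F.toFun J)) :=
    fun x J => hF.pair x _
  have hl := le_weight_of_one_le (w := genWt deg) (L := K) fun i _ => hpos i
  match K, hK, hl with
  | [], hK, _ => simp at hK
  | [i], hK, _ =>
    simp only [HomogMultivector.squareEval, List.map_cons, List.map_nil, unsh,
      HomogMultivector.squareTerm, hlast, map_add, hsign]
    simp [htop]
  | [i, j], hK, _ =>
    have h2 := hlast [hp.gen i, hp.gen j]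
    simp only [List.cons_append, List.nil_append] at h2
    simp only [HomogMultivector.squareEval, List.map_cons, List.map_nil, unsh,
      HomogMultivector.squareTerm, map_add, hsign, List.cons_append, List.nil_append, hpair,
      h2, hF.single, hres.quasiIso.map_differential]
    simp
  | [i, j, k], hK, _ =>
    simp only [weight_cons, weight_nil, genWt] at hK
    have hwt : ∀ i, deg i = 0 → (hp.gen i).wt = 1 := fun i hi => by
      change (deg i : ℤ) + 1 = 1
      omega
    have hi : (hp.gen i).wt = 1 := hwt i (by omega)
    have hj : (hp.gen j).wt = 1 := hwt j (by omega)
    have hk : (hp.gen k).wt = 1 := hwt k (by omega)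
    have h3 := hlast [hp.gen i, hp.gen j, hp.gen k]
    -- The inner value δz has degree -1, hence is zero.
    have hδ : ∀ x y z : Homog 𝒜, z.wt = 1 → F.toFun [x, y, F.app [z]] = 0 := by
      intro x y z hz
      refine F.map_zero [x, y] [] (hp.eq_zero_of_neg (d := weight Homog.wt [z] - 2) ?_ (F.mem _))
      simp [hz]
    simp only [List.cons_append, List.nil_append] at h3
    simp only [HomogMultivector.squareEval, List.map_cons, List.map_nil, unsh,
      HomogMultivector.squareTerm, map_add, hsign, List.cons_append, List.nil_append, htop, hpair,
      h3, hF.pair, hδ _ _ _ hi, hδ _ _ _ hj, hδ _ _ _ hk, weight_cons, weight_nil, hi, hj, hk]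
    have jac := hbr.jacobi (ε (u i)) (ε (u j)) (ε (u k))
    rw [hbr.skew (ε (u k)) (ε (u i)), map_neg] at jac
    have hval : ∀ i, (hp.gen i).val = u i := fun _ => rfl
    simp only [hval]
    simp
    linear_combination -jac
  | i :: j :: k :: l :: K, hK, hl =>
    rw [hK, List.length_cons, List.length_cons, List.length_cons, List.length_cons] at hl
    push_cast at hl
    omega

end Lift
-- Obstruction theory: induction on weight and passage to the limit.
section Construction

section Symbols

variable {A : Type*} [Ring A] [Algebra ℂ A] {𝒜 : ℤ → Submodule ℂ A} {ι : Type*} {deg : ι → ℕ}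

theorem inv_factorial_smul_symmSum_sym {m : ℤ} {y : List ι → A}
    (hy : ∀ K, y K ∈ 𝒜 (weight (genWt deg) K - m)) : IsSymbol 𝒜 deg m
      (fun K => ((K.length.factorial : ℂ)⁻¹) • symmSum (genWt deg) y K) where
  mem K := by
    refine Submodule.smul_mem _ _ (symmSum_mem (𝒜 (weight (genWt deg) K - m)).toAddSubgroup
      fun K' hK' => ?_)
    rw [← weight_perm _ hK']
    exact hy K'
  anti K i j K' := by
    rw [symmSum_anti, smul_comm]
    simp

theorem IsSymbol.add {m : ℤ} {c c' : List ι → A} (hc : IsSymbol 𝒜 deg m c)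
    (hc' : IsSymbol 𝒜 deg m c') : IsSymbol 𝒜 deg m (fun K => c K + c' K) where
  mem K := Submodule.add_mem _ (hc.mem K) (hc'.mem K)
  anti K i j K' := by rw [hc.anti, hc'.anti, smul_add]

end Symbols

variable {O : Type*} [CommRing O] [Algebra ℂ O] {br : O →ₗ[ℂ] O →ₗ[ℂ] O}
  {A : Type*} [Ring A] [Algebra ℂ A] {𝒜 : ℤ → Submodule ℂ A} [GradedAlgebra 𝒜]
  {δ : A →ₗ[ℂ] A} {ι : Type*} {deg : ι → ℕ} {u : ι → A} {ε : A →ₐ[ℂ] O}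

theorem eq_of_weight_le (hp : IsPolynomialOn 𝒜 deg u) (D : PartialDerivatives 𝒜 deg u)
    (hcomm : ∀ p q a b, a ∈ 𝒜 p → b ∈ 𝒜 q → a * b = (p * q).negOnePow • (b * a))
    {m N : ℤ} {c c' : List ι → A} (hc : IsSymbol 𝒜 deg m c) (hc' : IsSymbol 𝒜 deg m c')
    (h : ∀ K, weight (genWt deg) K ≤ N → c K = c' K) (L : List (Homog 𝒜))
    (hL : weight Homog.wt L ≤ N) :
    (D.multivector hcomm c hc).toFun L = (D.multivector hcomm c' hc').toFun L := by
  refine hp.ext_of_weight_le (fun K hK => ?_) L hL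
  rw [D.multivector_gen hp hcomm, D.multivector_gen hp hcomm, h K hK]

/-- The values on generators of a homotopy Poisson structure up to weight `N`. -/
structure IsPartialSolution (br : O →ₗ[ℂ] O →ₗ[ℂ] O) (hres : IsResolution 𝒜 δ deg u ε)
    (D : PartialDerivatives 𝒜 deg u) (N : ℤ) (c : List ι → A) : Prop where
  sym : IsSymbol 𝒜 deg 2 c
  single : ∀ i, c [i] = δ (u i)
  pair : ∀ i j, deg i = 0 → deg j = 0 → ε (c [i, j]) = br (ε (u i)) (ε (u j))
  square : ∀ K, weight (genWt deg) K ≤ N →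
    (D.multivector hres.dga.mul_comm c sym).squareEval (K.map hres.polynomial.gen) = 0

theorem isLift_multivector (hbr : IsPoisson br) (hres : IsResolution 𝒜 δ deg u ε)
    (D : PartialDerivatives 𝒜 deg u) {c : List ι → A} (sym : IsSymbol 𝒜 deg 2 c)
    (single : ∀ i, c [i] = δ (u i))
    (pair : ∀ i j, deg i = 0 → deg j = 0 → ε (c [i, j]) = br (ε (u i)) (ε (u j))) :
    IsLift br δ ε (D.multivector hres.dga.mul_comm c sym) := by
  have h := D.multivector_gen hres.polynomial hres.dga.mul_comm sym
  refine IsLift.of_gen hbr hres (fun i => ?_) fun i j hi hj => ?_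
  · rw [← single, ← h [i]]
    rfl
  · rw [← pair i j hi hj, ← h [i, j]]
    rfl

/-- The obstruction is a cycle by the Bianchi identity, and in the only degree with homology, degree
0, its image under ε vanishes. The vanishing of b on short lists keeps the order 1 component equal
to δ. -/
theorem IsPartialSolution.exists_primitive (hbr : IsPoisson br)
    {hres : IsResolution 𝒜 δ deg u ε} {D : PartialDerivatives 𝒜 deg u} {N : ℤ} {c : List ι → A}
    (hc : IsPartialSolution br hres D N c) (K : List ι)
    (hK : weight (genWt deg) K = N + 1) :
    ∃ b ∈ 𝒜 (weight (genWt deg) K - 2), δ b =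
      - (D.multivector hres.dga.mul_comm c hc.sym).squareEval (K.map hres.polynomial.gen) ∧
      (K.length ≤ 1 → b = 0) := by
  have hp := hres.polynomial
  set F := D.multivector hres.dga.mul_comm c hc.sym with hF
  have hlift : IsLift br δ ε F := isLift_multivector hbr hres D hc.sym hc.single hc.pair
  have hpos := hp.one_le_wt_of_mem K
  have hw : weight Homog.wt (K.map hp.gen) = N + 1 := by rw [hp.weight_gen, hK]
  have hsq : ∀ L, weight Homog.wt L ≤ N → F.squareEval L = 0 := fun L hL =>
    hp.ext_of_weight_le (F := F.square) (G := 0) (fun K hK => hc.square K hK) L hL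
  have hcyc : δ (F.squareEval (K.map hp.gen)) = 0 := by
    rw [← HomogMultivector.toFun_square_eq_zero hsq hpos hw, hlift.single]
    rfl
  have hmem := F.squareEval_mem (K.map hp.gen)
  rw [hp.weight_gen] at hmem
  -- On lists of length at most 1 the square is already zero, by F[] = 0 and δ² = 0.
  by_cases hlen : K.length ≤ 1
  · refine ⟨0, Submodule.zero_mem _, ?_, fun _ => rfl⟩
    have hnil : (F.app []).val = 0 := IsLift.toFun_nil hres F
    match K, hlen with
    | [], _ =>
      have : F.toFun [F.app []] = 0 := F.map_zero [] [] hnil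
      simp [HomogMultivector.squareEval, unsh, HomogMultivector.squareTerm, this]
    | [i], _ =>
      have h₁ : F.toFun ([hp.gen i] ++ [F.app []]) = 0 := F.map_zero [_] [] hnil
      have h₂ : F.toFun ([] ++ [F.app [hp.gen i]]) = 0 := by
        rw [List.nil_append, hlift.single]
        change δ (F.toFun [hp.gen i]) = 0
        rw [hlift.single, hres.dga.square]
      rw [HomogMultivector.squareEval, List.map_cons, List.map_nil, unsh, unsh,
        HomogMultivector.squareTerm, HomogMultivector.squareTerm, h₁, h₂]
      simp
  -- Weight 3 is degree 0 of the square, where a cycle bounds only if ε kills it; all other degrees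
  -- are acyclic.
  · by_cases h3 : weight (genWt deg) K = 3
    · have hε := hlift.map_squareEval hbr hres h3
      rw [h3] at hmem
      obtain ⟨b, hb, e⟩ := hres.quasiIso.injective _ hmem hcyc hε
      refine ⟨-b, Submodule.neg_mem _ (by rw [h3]; exact hb), by rw [map_neg, e],
        fun h => absurd h hlen⟩
    · obtain ⟨b, hb, e⟩ := hres.quasiIso.exact _ (by omega) _ hmem hcyc
      refine ⟨-b, Submodule.neg_mem _ ?_, by rw [map_neg, e], fun h => absurd h hlen⟩
      convert hb using 2
      ring

-- The averaged primitive is added in weight N + 1 alone. Since N ≥ 2, the values on pairs of degree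
-- 0 generators, of weight 2, are untouched.
open Classical in
theorem IsPartialSolution.exists_succ (hbr : IsPoisson br)
    {hres : IsResolution 𝒜 δ deg u ε} {D : PartialDerivatives 𝒜 deg u} {N : ℤ} (hN : 2 ≤ N)
    {c : List ι → A} (hc : IsPartialSolution br hres D N c) :
    ∃ c', IsPartialSolution br hres D (N + 1) c' ∧
      ∀ K, weight (genWt deg) K ≤ N → c' K = c K := by
  have hp := hres.polynomial
  set F := D.multivector hres.dga.mul_comm c hc.sym with hF
  have hlift : IsLift br δ ε F := isLift_multivector hbr hres D hc.sym hc.single hc.pair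
  have hex : ∀ K : List ι, ∃ b ∈ 𝒜 (weight (genWt deg) K - 2),
      (δ b = if weight (genWt deg) K = N + 1 then - F.squareEval (K.map hp.gen) else 0) ∧
      (K.length ≤ 1 → b = 0) ∧ (weight (genWt deg) K ≠ N + 1 → b = 0) := by
    intro K
    by_cases hK : weight (genWt deg) K = N + 1
    · obtain ⟨b, hb, e, hl⟩ := hc.exists_primitive hbr K hK
      exact ⟨b, hb, by rw [if_pos hK, e], hl, fun h => absurd hK h⟩
    · exact ⟨0, Submodule.zero_mem _, by rw [if_neg hK, map_zero], fun _ => rfl, fun _ => rfl⟩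
  choose y hmem hδ hlen hne using hex
  have hvsym := inv_factorial_smul_symmSum_sym hmem
  set v : List ι → A := fun K => ((K.length.factorial : ℂ)⁻¹) • symmSum (genWt deg) y K with hv
  have hv0 : ∀ K, weight (genWt deg) K ≠ N + 1 → v K = 0 := by
    intro K hK
    have : symmSum (genWt deg) y K ∈ (⊥ : AddSubgroup A) := symmSum_mem _ fun K' hK' =>
      AddSubgroup.mem_bot.2 (hne K' (by rwa [weight_perm _ hK']))
    simp only [hv, AddSubgroup.mem_bot.1 this, smul_zero]
  have hv1 : ∀ i, v [i] = 0 := by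
    intro i
    have : symmSum (genWt deg) y [i] = 0 := hlen [i] (by simp)
    simp [hv, this]
  have hvδ : ∀ K, weight (genWt deg) K = N + 1 → δ (v K) = - F.squareEval (K.map hp.gen) := by
    intro K hK
    have h := map_symmSum (w := genWt deg) δ.toAddMonoidHom y K
    simp only [LinearMap.toAddMonoidHom_coe, hδ] at h
    -- δ commutes with the symmetrization, and the opposite of the square is already antisymmetric,
    -- so averaging does not change it.
    rw [symmSum_of_anti (G := fun K => if weight (genWt deg) K = N + 1 then
      - F.squareEval (K.map hp.gen) else 0), if_pos hK] at h
    · simp only [hv]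
      rw [map_smul, h, ← Nat.cast_smul_eq_nsmul ℂ, smul_smul, inv_mul_cancel₀, one_smul]
      exact Nat.cast_ne_zero.2 (Nat.factorial_ne_zero _)
    · intro L i j L'
      have hw : weight (genWt deg) (L ++ j :: i :: L') = weight (genWt deg) (L ++ i :: j :: L') :=
        weight_perm _ ((List.Perm.swap i j L').append_left L)
      rw [hw]
      split_ifs
      · simp only [List.map_append, List.map_cons]
        rw [F.squareEval_anti, smul_neg]
        rfl
      · rw [smul_zero]
  have hsym := hc.sym.add hvsym
  have hle : ∀ K, weight (genWt deg) K ≤ N → c K + v K = c K := fun K hK => by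
    rw [hv0 K (by omega), add_zero]
  have hsingle : ∀ i, c [i] + v [i] = δ (u i) := fun i => by rw [hv1, add_zero, hc.single]
  have hpair : ∀ i j, deg i = 0 → deg j = 0 →
      ε (c [i, j] + v [i, j]) = br (ε (u i)) (ε (u j)) := fun i j hi hj => by
    rw [hle [i, j] (by simp [genWt, hi, hj]; omega), hc.pair i j hi hj]
  refine ⟨fun K => c K + v K, ⟨hsym, hsingle, hpair, fun K hK => ?_⟩, hle⟩
  set F' := D.multivector hres.dga.mul_comm _ hsym with hF'
  have hlift' : IsLift br δ ε F' := isLift_multivector hbr hres D hsym hsingle hpair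
  have hFF' := eq_of_weight_le hp D hres.dga.mul_comm hsym hc.sym hle
  have hw := hp.weight_gen K
  rcases hK.lt_or_eq with hK | hK
  · rw [HomogMultivector.squareEval_congr hFF' (hp.one_le_wt_of_mem K) (by omega)]
    exact hc.square K (by omega)
  -- The square changes by δ(c + v) - δ(c) = δv, which is its opposite before the correction.
  · have h := HomogMultivector.squareEval_sub hFF' (hp.one_le_wt_of_mem K) (by omega)
    rw [← hF, hlift.single, hlift.single] at h
    have e₁ : (F'.app (K.map hp.gen)).val = c K + v K :=
      D.multivector_gen hp hres.dga.mul_comm hsym K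
    have e₂ : (F.app (K.map hp.gen)).val = c K :=
      D.multivector_gen hp hres.dga.mul_comm hc.sym K
    rw [e₁, e₂, map_add, add_sub_cancel_left, hvδ K hK] at h
    rwa [sub_eq_iff_eq_add, neg_add_cancel] at h

theorem IsPartialSolution.exists_two (hbr : IsPoisson br) (hres : IsResolution 𝒜 δ deg u ε)
    (D : PartialDerivatives 𝒜 deg u) : ∃ c, IsPartialSolution br hres D 2 c := by
  classical
  have hp := hres.polynomial
  choose y hy _ hyε using fun i j : ι => hres.quasiIso.surjective (br (ε (u i)) (ε (u j)))
  -- The starting values: δ in order 1, an antisymmetrized lift of the bracket on pairs of degree 0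
  -- generators, zero otherwise.
  set c : List ι → A := fun K => match K with
    | [i] => δ (u i)
    | [i, j] => if deg i = 0 ∧ deg j = 0 then (2⁻¹ : ℂ) • (y i j - y j i) else 0
    | _ => 0 with hc
  have hsym : IsSymbol 𝒜 deg 2 c := by
    refine ⟨fun K => ?_, fun K i j K' => ?_⟩
    · match K with
      | [] => exact Submodule.zero_mem _
      | [i] =>
        have := hres.dga.map_mem _ _ (hp.mem i)
        change δ (u i) ∈ _
        convert this using 2
        simp [genWt]
        ring
      | [i, j] =>
        change (if deg i = 0 ∧ deg j = 0 then (2⁻¹ : ℂ) • (y i j - y j i) else 0) ∈ _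
        split_ifs with h
        · have : weight (genWt deg) [i, j] - 2 = 0 := by simp [genWt, h.1, h.2]
          rw [this]
          exact Submodule.smul_mem _ _ (Submodule.sub_mem _ (hy i j) (hy j i))
        · exact Submodule.zero_mem _
      | _ :: _ :: _ :: _ => exact Submodule.zero_mem _
    · match K, K' with
      | [], [] =>
        change (if deg j = 0 ∧ deg i = 0 then (2⁻¹ : ℂ) • (y j i - y i j) else 0) =
          _ • (if deg i = 0 ∧ deg j = 0 then (2⁻¹ : ℂ) • (y i j - y j i) else 0)
        by_cases h : deg i = 0 ∧ deg j = 0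
        · rw [if_pos h, if_pos h.symm]
          simp only [genWt, h.1, h.2]
          simp [← smul_neg]
        · rw [if_neg h, if_neg fun h' => h h'.symm, smul_zero]
      | [], _ :: _ => exact (smul_zero _).symm
      | [_], _ => exact (smul_zero _).symm
      | _ :: _ :: K, K' =>
        cases K <;> exact (smul_zero _).symm
  refine ⟨c, hsym, fun i => rfl, fun i j hi hj => ?_, fun K hK => ?_⟩
  · change ε (if deg i = 0 ∧ deg j = 0 then (2⁻¹ : ℂ) • (y i j - y j i) else 0) = _
    rw [if_pos ⟨hi, hj⟩, map_smul, map_sub, hyε, hyε, hbr.skew (ε (u j)), sub_neg_eq_add,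
      ← two_smul ℂ, smul_smul, inv_mul_cancel₀ two_ne_zero, one_smul]
  -- In weight at most 2 the square has negative degree.
  · refine hp.eq_zero_of_neg ?_ (HomogMultivector.squareEval_mem _ _)
    rw [hp.weight_gen]
    omega

/-- There is a multivector of square zero that lifts the bracket. -/
theorem exists_square_eq_zero (hbr : IsPoisson br) (hres : IsResolution 𝒜 δ deg u ε) :
    ∃ (c : List ι → A) (D : PartialDerivatives 𝒜 deg u) (hc : IsSymbol 𝒜 deg 2 c),
      IsLift br δ ε (D.multivector hres.dga.mul_comm c hc) ∧
      ∀ L, (D.multivector hres.dga.mul_comm c hc).squareEval L = 0 := by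
  have hp := hres.polynomial
  obtain ⟨D⟩ := hp.nonempty_partialDerivatives hres.dga.mul_comm
  obtain ⟨c₀, hc₀⟩ := IsPartialSolution.exists_two hbr hres D
  choose next hnext hagree using fun (N : ℤ) (hN : 2 ≤ N) (c : List ι → A)
    (hc : IsPartialSolution br hres D N c) => hc.exists_succ hbr hN
  let a : (n : ℕ) → {c : List ι → A // IsPartialSolution br hres D ((n : ℤ) + 2) c} := fun n =>
    Nat.rec ⟨c₀, by simpa using hc₀⟩ (fun n c => ⟨next _ (by omega) c.1 c.2, by
      have := hnext ((n : ℤ) + 2) (by omega) c.1 c.2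
      rwa [show ((n + 1 : ℕ) : ℤ) + 2 = (n : ℤ) + 2 + 1 by push_cast; ring]⟩) n
  have hstep : ∀ (n : ℕ) K, weight (genWt deg) K ≤ (n : ℤ) + 2 → (a (n + 1)).1 K = (a n).1 K :=
    fun n K hK => hagree ((n : ℤ) + 2) (by omega) (a n).1 (a n).2 K hK
  have hstable : ∀ (n k : ℕ) K, weight (genWt deg) K ≤ (n : ℤ) + 2 → (a (n + k)).1 K = (a n).1 K := by
    intro n k K hK
    induction k with
    | zero => rfl
    | succ k ih => rw [← add_assoc, hstep _ K (by push_cast; omega), ih]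
  -- Stage n is final on lists of weight at most n + 2, so the stage indexed by the weight of K
  -- already gives its limiting value.
  set c : List ι → A := fun K => (a (weight (genWt deg) K).toNat).1 K with hcdef
  have hc : ∀ (n : ℕ) K, weight (genWt deg) K ≤ (n : ℤ) → c K = (a n).1 K := by
    intro n K hK
    obtain ⟨k, hk⟩ := Nat.exists_eq_add_of_le (Int.toNat_le.2 hK)
    rw [hk, hstable _ k K (by have := Int.self_le_toNat (weight (genWt deg) K); omega)]
  have hsym : IsSymbol 𝒜 deg 2 c := by
    refine ⟨fun K => (a _).2.sym.mem K, fun K i j K' => ?_⟩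
    have hw : weight (genWt deg) (K ++ j :: i :: K') = weight (genWt deg) (K ++ i :: j :: K') :=
      weight_perm _ ((List.Perm.swap i j K').append_left K)
    rw [hc _ _ (hw.le.trans (Int.self_le_toNat _)), hc _ _ (Int.self_le_toNat _)]
    exact (a _).2.sym.anti K i j K'
  have hsingle : ∀ i, c [i] = δ (u i) := fun i => (a _).2.single i
  have hpair : ∀ i j, deg i = 0 → deg j = 0 → ε (c [i, j]) = br (ε (u i)) (ε (u j)) :=
    fun i j => (a _).2.pair i j
  refine ⟨c, D, hsym, isLift_multivector hbr hres D hsym hsingle hpair, fun L => ?_⟩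
  refine hp.ext_of_weight_le (N := weight Homog.wt L)
    (F := (D.multivector hres.dga.mul_comm c hsym).square) (G := 0) (fun K _ => ?_) L le_rfl
  have hK := Int.self_le_toNat (weight (genWt deg) K)
  refine (HomogMultivector.squareEval_congr (N := weight (genWt deg) K)
    (eq_of_weight_le hp D hres.dga.mul_comm hsym (a (weight (genWt deg) K).toNat).2.sym
      fun K' hK' => hc _ K' (hK'.trans hK)) (hp.one_le_wt_of_mem K) (hp.weight_gen K).le).trans ?_
  exact (a (weight (genWt deg) K).toNat).2.square K (by omega)

end Construction
-- From lists of homogeneous elements to multilinear maps and sums over subsets.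
theorem finRange_split {s : ℕ} (i : Fin s) : ∃ K L : List (Fin s), List.finRange s = K ++ i :: L ∧
    (∀ j, j ∈ K ↔ j < i) ∧ (∀ j, j ∈ L ↔ i < j) ∧ (K ++ L).Pairwise (· < ·) := by
  obtain ⟨K, L, h⟩ := List.append_of_mem (List.mem_finRange i)
  have hs := List.pairwise_lt_finRange s
  have hall : ∀ j, j ∈ K ++ i :: L := fun j => h ▸ List.mem_finRange j
  rw [h] at hs
  have hKL : (K ++ L).Pairwise (· < ·) :=
    hs.sublist ((List.sublist_cons_self i L).append_left K)
  rw [List.pairwise_append, List.pairwise_cons] at hs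
  obtain ⟨-, ⟨hL, -⟩, hK⟩ := hs
  refine ⟨K, L, h, fun j => ⟨fun hj => hK j hj i List.mem_cons_self, fun hj => ?_⟩,
    fun j => ⟨fun hj => hL j hj, fun hj => ?_⟩, hKL⟩
  · rcases List.mem_append.1 (hall j) with h | h
    · exact h
    · rcases List.mem_cons.1 h with rfl | h
      · exact absurd hj (lt_irrefl _)
      · exact absurd hj (hL j h).asymm
  · rcases List.mem_append.1 (hall j) with h | h
    · exact absurd hj (hK j h i List.mem_cons_self).asymm
    · rcases List.mem_cons.1 h with rfl | h
      · exact absurd hj (lt_irrefl _)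
      · exact h

theorem weight_map_eq_sum {s : ℕ} {α : Type*} (w : α → ℤ) (X : Fin s → α) {K : List (Fin s)}
    (hK : K.Pairwise (· < ·)) {S : Finset (Fin s)} (h : ∀ j, j ∈ K ↔ j ∈ S) :
    weight w (K.map X) = ∑ j ∈ S, w (X j) := by
  have : S = K.toFinset := by
    ext j
    rw [List.mem_toFinset, h]
  rw [this, List.sum_toFinset _ (hK.imp fun h => h.ne), weight, List.map_map]
  rfl

section Eval

variable {A : Type*} [Ring A] [Algebra ℂ A] {𝒜 : ℤ → Submodule ℂ A}
  {ι : Type*} {deg : ι → ℕ} {u : ι → A}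

open Function in
/-- The multivector of order `s` with given values on lists of generators. -/
noncomputable def PartialDerivatives.toMultivector [GradedAlgebra 𝒜]
    (D : PartialDerivatives 𝒜 deg u)
    (hcomm : ∀ p q a b, a ∈ 𝒜 p → b ∈ 𝒜 q → a * b = (p * q).negOnePow • (b * a))
    {m : ℤ} (c : List ι → A) (hc : IsSymbol 𝒜 deg m c) (s : ℕ) : Multivector 𝒜 s m where
  toFun :=
    { toFun := fun f => D.contract ((List.finRange s).map f) m c
      map_update_add' := by
        intro inst f i x y
        obtain rfl : inst = instDecidableEqFin s := Subsingleton.elim _ _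
        obtain ⟨K, L, h, hK, hL, -⟩ := finRange_split i
        have hmap : ∀ z, (List.finRange s).map (update f i z) = K.map f ++ z :: L.map f := by
          intro z
          rw [h, List.map_append, List.map_cons, update_self]
          congr 1
          · exact List.map_congr_left fun j hj => update_of_ne ((hK j).1 hj).ne _ _
          · congr 1
            exact List.map_congr_left fun j hj => update_of_ne ((hL j).1 hj).ne' _ _
        have := D.contract_lin (K.map f) (L.map f) m c 1 x y
        rw [hmap, hmap, hmap]
        simpa using this
      map_update_smul' := by
        intro inst f i r x
        obtain rfl : inst = instDecidableEqFin s := Subsingleton.elim _ _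
        obtain ⟨K, L, h, hK, hL, -⟩ := finRange_split i
        have hmap : ∀ z, (List.finRange s).map (update f i z) = K.map f ++ z :: L.map f := by
          intro z
          rw [h, List.map_append, List.map_cons, update_self]
          congr 1
          · exact List.map_congr_left fun j hj => update_of_ne ((hK j).1 hj).ne _ _
          · congr 1
            exact List.map_congr_left fun j hj => update_of_ne ((hL j).1 hj).ne' _ _
        have h0 := D.contract_lin (K.map f) (L.map f) m c 1 0 0
        rw [one_smul, one_smul, add_zero, left_eq_add] at h0
        have := D.contract_lin (K.map f) (L.map f) m c r x 0
        rw [hmap, hmap, ← add_zero (r • x), this, h0, add_zero] }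
  map_mem d f hf := by
    have := D.contract_mem ((List.finRange s).map fun i => (⟨d i, f i, hf i⟩ : Homog 𝒜)) hc
    rw [weight_map_eq_sum _ _ (List.pairwise_lt_finRange s) (S := Finset.univ) (by simp),
      List.map_map] at this
    exact this
  antisymm d f hf i j hij := by
    obtain ⟨K, L, h, hK, hL, hKL⟩ := finRange_split i
    have hlt : i < j := by rw [Fin.lt_def]; omega
    obtain ⟨L₁, L₂, rfl⟩ := List.append_of_mem ((hL j).2 hlt)
    have hp := List.pairwise_lt_finRange s
    rw [h, List.pairwise_append, List.pairwise_cons, List.pairwise_append, List.pairwise_cons] at hp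
    obtain ⟨-, ⟨-, -, ⟨hL₂, -⟩, hL₁⟩, -⟩ := hp
    -- The indices i and j are consecutive, so nothing lies between them.
    obtain rfl : L₁ = [] := by
      refine List.eq_nil_iff_forall_not_mem.2 fun b hb => ?_
      have h₁ := (hL b).1 (List.mem_append_left _ hb)
      have h₂ := hL₁ b hb j List.mem_cons_self
      rw [Fin.lt_def] at h₁ h₂
      omega
    set X : Fin s → Homog 𝒜 := fun i => ⟨d i, f i, hf i⟩
    have key := D.contract_anti hcomm hc (K.map X) (X i) (X j) (L₂.map X)
    simp only [List.map_append, List.map_cons, List.map_map] at key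
    change D.contract ((List.finRange s).map (f ∘ Equiv.swap i j)) m c =
      _ • D.contract ((List.finRange s).map f) m c
    rw [h]
    simp only [List.nil_append, List.map_append, List.map_cons]
    refine Eq.trans ?_ key
    congr 2
    · refine List.map_congr_left fun k hk => ?_
      have hki := (hK k).1 hk
      simp only [Function.comp_apply, Equiv.swap_apply_of_ne_of_ne hki.ne (hki.trans hlt).ne]
      rfl
    · simp only [Function.comp_apply, Equiv.swap_apply_left, Equiv.swap_apply_right]
      congr 2
      refine List.map_congr_left fun k hk => ?_
      have hkj := hL₂ k hk
      simp only [Function.comp_apply, Equiv.swap_apply_of_ne_of_ne (hlt.trans hkj).ne' hkj.ne']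
      rfl
  leibniz d f hf i p q a b ha hb := by
    obtain ⟨K, L, h, hK, hL, hKL⟩ := finRange_split i
    set X : Fin s → Homog 𝒜 := fun i => ⟨d i, f i, hf i⟩
    have hmap : ∀ z, (List.finRange s).map (update f i z) =
        (K.map X).map Homog.val ++ z :: (L.map X).map Homog.val := by
      intro z
      rw [h, List.map_append, List.map_cons, update_self, List.map_map, List.map_map]
      congr 1
      · exact List.map_congr_left fun j hj => update_of_ne ((hK j).1 hj).ne _ _
      · congr 1
        exact List.map_congr_left fun j hj => update_of_ne ((hL j).1 hj).ne' _ _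
    have key := (D.multivector hcomm c hc).leib_at (K.map X) (L.map X) ⟨p, a, ha⟩ ⟨q, b, hb⟩
      ⟨p + q, a * b, SetLike.mul_mem_graded ha hb⟩ rfl rfl
    rw [List.pairwise_append] at hKL
    rw [weight_map_eq_sum _ _ hKL.1 (S := Finset.Iio i) (by simp [hK]),
      weight_map_eq_sum _ _ hKL.2.1 (S := Finset.Ioi i) (by simp [hL])] at key
    change D.contract ((List.finRange s).map _) m c = _ • (D.contract ((List.finRange s).map _) m c * b)
      + _ • (a * D.contract ((List.finRange s).map _) m c)
    rw [hmap, hmap, hmap]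
    simp only [PartialDerivatives.multivector, List.map_append, List.map_cons] at key
    exact key

/-- The head x is the smallest index: placed in I it creates no inversion, placed in the complement
it is inverted with every element of I. The recursive sign is therefore the Koszul sign counted by
inversions. -/
theorem unsh_map_eq_sum {α M : Type*} [AddCommGroup M] {w : α → ℤ} {s : ℕ} (X : Fin s → α)
    (G : List α → List α → M) {L : List (Fin s)} (hL : L.Pairwise (· < ·)) :
    unsh w (L.map X) G = ∑ I ∈ L.toFinset.powerset,
      (∑ i ∈ I, ∑ j ∈ L.toFinset \ I with j < i, w (X i) * w (X j)).negOnePow •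
        G (I.sort.map X) ((L.toFinset \ I).sort.map X) := by
  induction L generalizing G with
  | nil => simp [unsh]
  | cons x L ih =>
    rw [List.pairwise_cons] at hL
    have hx : ∀ {I : Finset (Fin s)}, I ⊆ L.toFinset → ∀ i ∈ I, x < i := fun hI i hi =>
      hL.1 i (List.mem_toFinset.1 (hI hi))
    have hx' : ∀ {I : Finset (Fin s)}, I ⊆ L.toFinset → x ∉ I := fun hI h =>
      lt_irrefl x (hx hI x h)
    have hsort : ∀ {I : Finset (Fin s)}, I ⊆ L.toFinset →
        (insert x I).sort.map X = X x :: I.sort.map X := fun hI => by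
      rw [Finset.sort_insert _ (fun i hi => (hx hI i hi).le) (hx' hI), List.map_cons]
    rw [List.map_cons, unsh, ih _ hL.2, List.toFinset_cons,
      Finset.sum_powerset_insert (hx' subset_rfl), ← Finset.sum_add_distrib]
    refine Finset.sum_congr rfl fun I hI => ?_
    rw [Finset.mem_powerset] at hI
    have hd : L.toFinset \ I ⊆ L.toFinset := Finset.sdiff_subset
    have h₁ : insert x L.toFinset \ insert x I = L.toFinset \ I := by
      ext j
      simp only [Finset.mem_sdiff, Finset.mem_insert, not_or]
      constructor
      · rintro ⟨rfl | h, h₁, h₂⟩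
        · exact absurd rfl h₁
        · exact ⟨h, h₂⟩
      · rintro ⟨h, h₂⟩
        exact ⟨Or.inr h, (hx subset_rfl j h).ne', h₂⟩
    have h₂ : insert x L.toFinset \ I = insert x (L.toFinset \ I) :=
      Finset.insert_sdiff_of_notMem _ (hx' hI)
    rw [smul_add, add_comm, h₁, h₂, hsort hI, hsort hd, smul_smul, ← Int.negOnePow_add]
    congr 3
    · rw [weight_map_eq_sum w X (Finset.sortedLT_sort I).pairwise (S := I) (by simp),
        Finset.mul_sum, ← Finset.sum_add_distrib]
      refine Finset.sum_congr rfl fun i hi => ?_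
      rw [Finset.filter_insert, if_pos (hx hI i hi), Finset.sum_insert]
      · ring
      · exact fun h => hx' hd (Finset.mem_filter.1 h).1
    · rw [Finset.sum_insert (hx' hI), Finset.filter_eq_empty_iff.2, Finset.sum_empty, zero_add]
      intro j hj
      exact (hx hd j hj).asymm

end Eval
-- From vanishing square to the Maurer–Cartan equation.
section MaurerCartan

variable {A : Type*} [Ring A] [Algebra ℂ A] {𝒜 : ℤ → Submodule ℂ A} {ι : Type*} {deg : ι → ℕ}
  {u : ι → A}

namespace PartialDerivatives

variable (D : PartialDerivatives 𝒜 deg u)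

theorem contract_congr {L : List A} {m : ℤ} {c c' : List ι → A}
    (h : ∀ K, K.length = L.length → c K = c' K) : D.contract L m c = D.contract L m c' := by
  induction L generalizing m c c' with
  | nil => exact h [] rfl
  | cons f L ih =>
    simp only [contract]
    refine Finsupp.sum_congr fun i _ => ?_
    rw [ih fun K hK => h (i :: K) (by simp [hK])]

theorem contract_zero (L : List A) (m : ℤ) : D.contract L m (fun _ => 0) = 0 := by
  induction L generalizing m with
  | nil => rfl
  | cons f L ih => simp [contract, ih]

theorem contract_zero_entry (L L' : List A) (m : ℤ) (c : List ι → A) :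
    D.contract (L ++ 0 :: L') m c = 0 := by
  have h := D.contract_lin L L' m c 1 0 0
  rwa [one_smul, one_smul, add_zero, left_eq_add] at h

end PartialDerivatives

/-- The components of order at least `2` of a multivector. -/
def truncate (c : List ι → A) (K : List ι) : A := if K.length < 2 then 0 else c K

theorem IsSymbol.truncate {m : ℤ} {c : List ι → A} (hc : IsSymbol 𝒜 deg m c) :
    IsSymbol 𝒜 deg m (truncate c) where
  mem K := by
    rw [HoPoisson.truncate]
    split_ifs
    · exact Submodule.zero_mem _
    · exact hc.mem K
  anti K i j K' := by
    rw [HoPoisson.truncate, HoPoisson.truncate, if_neg (by simp; omega), if_neg (by simp; omega)]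
    exact hc.anti K i j K'

theorem PartialDerivatives.contract_truncate (D : PartialDerivatives 𝒜 deg u) (L : List A) (m : ℤ)
    (c : List ι → A) : D.contract L m (truncate c) =
      if L.length < 2 then 0 else D.contract L m c := by
  split_ifs with h
  · rw [← D.contract_zero L m]
    exact D.contract_congr fun K hK => if_pos (hK ▸ h)
  · exact D.contract_congr fun K hK => if_neg (hK ▸ h)

variable [GradedAlgebra 𝒜]

namespace PartialDerivatives

variable (D : PartialDerivatives 𝒜 deg u)

/-- The term of `π ∘ π` for the decomposition `(I, Iᶜ)`. -/
noncomputable def circTerm (c : List ι → A) {N : ℕ} (d : Fin N → ℤ) (f : Fin N → A)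
    (I : Finset (Fin N)) : A :=
  (unshuffleExponent d I + ∑ i ∈ I, (d i + 1)).negOnePow •
    D.contract (I.sort.map f ++ [D.contract (Iᶜ.sort.map f) 2 c]) 2 c

variable (hcomm : ∀ p q a b, a ∈ 𝒜 p → b ∈ 𝒜 q → a * b = (p * q).negOnePow • (b * a))
  {c : List ι → A} (hc : IsSymbol 𝒜 deg 2 c)

theorem circEval_toMultivector {k l N : ℕ} (h : k + l = N + 1) (d : Fin N → ℤ) (f : Fin N → A) :
    circEval h (D.toMultivector hcomm c hc k) (D.toMultivector hcomm c hc l) d f =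
      ∑ I : Finset (Fin N) with I.card + 1 = k, D.circTerm c d f I := by
  rw [Finset.sum_subtype _ (p := fun I : Finset (Fin N) => I.card + 1 = k) (by simp)]
  refine Finset.sum_congr rfl fun I _ => ?_
  obtain ⟨I, rfl⟩ := I
  have hsort : ∀ {J : Finset (Fin N)} {n : ℕ} (hJ : J.card = n),
      (List.finRange n).map (fun i => f (J.orderEmbOfFin hJ i)) = J.sort.map f := fun {J n} hJ => by
    rw [← Finset.listMap_orderEmbOfFin_finRange J hJ, List.map_map]
    rfl
  rw [circTerm, show (2 - 1 : ℤ) = 1 from rfl, one_mul]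
  congr 1
  change D.contract (List.map _ _) 2 c = _
  congr 1
  rw [← List.ofFn_eq_map, List.ofFn_succ', List.concat_eq_append, List.ofFn_eq_map,
    ← hsort (rfl : I.card = _), ← hsort (card_compl_of_decomposition h rfl)]
  congr 1
  · refine List.map_congr_left fun i _ => ?_
    exact Fin.snoc_castSucc (α := fun _ => A) _ _ i
  · congr 1
    exact Fin.snoc_last (α := fun _ => A) _ _

/-- In upper degree 2 the bracket is P ∘ Q + Q ∘ P, so half the sum over ordered pairs counts each
composite once. The orders then partition the subsets I by cardinality. -/
theorem half_sum_schoutenEval {s : ℕ} (d : Fin s → ℤ) (f : Fin s → A) :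
    (1 / 2 : ℂ) • ∑ x : {x : ℕ × ℕ // x ∈ Finset.HasAntidiagonal.antidiagonal (s + 1)},
        schoutenEval (Finset.HasAntidiagonal.mem_antidiagonal.1 x.2)
          (D.toMultivector hcomm c hc x.1.1) (D.toMultivector hcomm c hc x.1.2) d f =
      ∑ I, D.circTerm c d f I := by
  set S : ℕ → A := fun k => ∑ I : Finset (Fin s) with I.card + 1 = k, D.circTerm c d f I with hS
  have h₁ : ∑ x ∈ Finset.HasAntidiagonal.antidiagonal (s + 1), S x.1 =
      ∑ I, D.circTerm c d f I := by
    rw [Finset.Nat.sum_antidiagonal_eq_sum_range_succ_mk]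
    refine Finset.sum_fiberwise_of_maps_to (fun I _ => ?_) _
    have := I.card_le_univ
    rw [Fintype.card_fin] at this
    rw [Finset.mem_range]
    omega
  have h₂ : ∑ x ∈ Finset.HasAntidiagonal.antidiagonal (s + 1), S x.2 =
      ∑ I, D.circTerm c d f I := by
    rw [← h₁]
    exact Finset.Nat.sum_antidiagonal_swap (f := fun x => S x.1)
  have h₃ : ∑ x : {x : ℕ × ℕ // x ∈ Finset.HasAntidiagonal.antidiagonal (s + 1)},
      schoutenEval (Finset.HasAntidiagonal.mem_antidiagonal.1 x.2)
        (D.toMultivector hcomm c hc x.1.1) (D.toMultivector hcomm c hc x.1.2) d f =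
      ∑ x ∈ Finset.HasAntidiagonal.antidiagonal (s + 1), (S x.1 + S x.2) := by
    rw [← Finset.sum_coe_sort (Finset.HasAntidiagonal.antidiagonal (s + 1))
      (fun x : ℕ × ℕ => S x.1 + S x.2)]
    refine Finset.sum_congr rfl fun x _ => ?_
    rw [schoutenEval, D.circEval_toMultivector hcomm hc, D.circEval_toMultivector hcomm hc,
      show ((2 - 1) * (2 - 1) : ℤ) = 1 from rfl, Int.negOnePow_one, Units.neg_smul, one_smul,
      sub_neg_eq_add]
  rw [h₃, Finset.sum_add_distrib, h₁, h₂, ← two_smul ℂ, smul_smul]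
  norm_num

theorem squareEval_eq_sum {s : ℕ} (d : Fin s → ℤ) (f : Fin s → A) (hf : ∀ i, f i ∈ 𝒜 (d i)) :
    (D.multivector hcomm c hc).squareEval
      ((List.finRange s).map fun i => (⟨d i, f i, hf i⟩ : Homog 𝒜)) =
        ∑ I, D.circTerm c d f I := by
  rw [HomogMultivector.squareEval, unsh_map_eq_sum _ _ (List.pairwise_lt_finRange s),
    List.toFinset_finRange, Finset.powerset_univ]
  refine Finset.sum_congr rfl fun I _ => ?_
  rw [HomogMultivector.squareTerm, smul_smul, ← Int.negOnePow_add, circTerm,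
    weight_map_eq_sum _ _ (Finset.sortedLT_sort I).pairwise (S := I) (by simp),
    ← Finset.compl_eq_univ_sdiff]
  congr 1
  simp only [multivector, HomogMultivector.app, List.map_append, List.map_map, List.map_cons,
    List.map_nil]
  rfl

/-- The inner list is the single fᵢ, so the inner value is δfᵢ. Moving it from the last slot back to
position i turns the unshuffle sign into that of δ crossing the preceding symbols, because δfᵢ has
degree one less than fᵢ. -/
theorem circTerm_erase
    (hcomm : ∀ p q a b, a ∈ 𝒜 p → b ∈ 𝒜 q → a * b = (p * q).negOnePow • (b * a))
    {c : List ι → A} (hc : IsSymbol 𝒜 deg 2 c) {s : ℕ} (d : Fin s → ℤ) (f : Fin s → A) (hf : ∀ i, f i ∈ 𝒜 (d i))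
    {δ : A →ₗ[ℂ] A} (hδ : ∀ p a, a ∈ 𝒜 p → δ a ∈ 𝒜 (p - 1))
    (hsingle : ∀ x : Homog 𝒜, D.contract [x.val] 2 c = δ x.val) (i : Fin s) :
    D.circTerm c d f (Finset.univ.erase i) = (∑ j ∈ Finset.Iio i, (d j + 1)).negOnePow •
      D.contract ((List.finRange s).map (Function.update f i (δ (f i)))) 2 c := by
  obtain ⟨K, L, h, hK, hL, hKL⟩ := finRange_split i
  have hsort : (Finset.univ.erase i).sort = K ++ L := by
    refine (Finset.sortedLT_sort _).eq_of_mem_iff hKL.sortedLT fun j => ?_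
    simp [hK, hL, lt_or_lt_iff_ne]
  have hcompl : (Finset.univ.erase i)ᶜ = {i} := by
    ext j
    simp
  have hmap : (List.finRange s).map (Function.update f i (δ (f i))) =
      K.map f ++ δ (f i) :: L.map f := by
    rw [h, List.map_append, List.map_cons, Function.update_self]
    congr 1
    · exact List.map_congr_left fun j hj => Function.update_of_ne ((hK j).1 hj).ne _ _
    · congr 1
      exact List.map_congr_left fun j hj => Function.update_of_ne ((hL j).1 hj).ne' _ _
  set X : Fin s → Homog 𝒜 := fun i => ⟨d i, f i, hf i⟩ with hX
  rw [List.pairwise_append] at hKL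
  have key := (D.multivector hcomm c hc).move_last (K.map X) (L.map X)
    ⟨d i - 1, δ (f i), hδ _ _ (hf i)⟩
  rw [weight_map_eq_sum _ _ hKL.2.1 (S := Finset.Ioi i) (by simp [hL])] at key
  simp only [multivector, List.map_append, List.map_cons, List.map_map, List.map_nil] at key
  change D.contract (K.map f ++ δ (f i) :: L.map f) 2 c =
    _ • D.contract (K.map f ++ L.map f ++ [δ (f i)]) 2 c at key
  rw [hmap, key, circTerm, hcompl, hsort, Finset.sort_singleton, List.map_append, List.map_cons,
    List.map_nil, hsingle (X i), smul_smul, ← Int.negOnePow_add]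
  refine negOnePow_smul_congr_zmod ?_ _
  have hsum : ∑ j ∈ Finset.univ.erase i, (d j + 1) =
      ∑ j ∈ Finset.Iio i, (d j + 1) + ∑ j ∈ Finset.Ioi i, (d j + 1) := by
    rw [← Finset.sum_union]
    · congr 1
      ext j
      simp [lt_or_lt_iff_ne]
    · exact Finset.disjoint_left.2 fun j h₁ h₂ =>
        (Finset.mem_Iio.1 h₁).asymm (Finset.mem_Ioi.1 h₂)
  have hexp : unshuffleExponent d (Finset.univ.erase i) =
      (∑ j ∈ Finset.Ioi i, (d j + 1)) * (d i + 1) := by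
    rw [unshuffleExponent, hcompl, Finset.sum_mul]
    simp only [Finset.filter_singleton]
    rw [← Finset.sum_subset (s₁ := Finset.Ioi i)]
    · refine Finset.sum_congr rfl fun j hj => ?_
      rw [if_pos (Finset.mem_Ioi.1 hj), Finset.sum_singleton]
    · intro j hj
      simpa using (Finset.mem_Ioi.1 hj).ne'
    · intro j _ hj
      rw [if_neg fun h => hj (Finset.mem_Ioi.2 h), Finset.sum_empty]
  rw [hsum, hexp]
  change _ = (((∑ j ∈ Finset.Iio i, (d j + 1)) +
    ((d i - 1 + 1) * ∑ j ∈ Finset.Ioi i, (d j + 1)) : ℤ) : ZMod 2)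
  generalize ∑ j ∈ Finset.Iio i, (d j + 1) = a
  generalize ∑ j ∈ Finset.Ioi i, (d j + 1) = b
  push_cast
  grind

end PartialDerivatives

/-- Truncation loses the terms with an outer or an inner factor of order at most 1: I = ∅ gives δ ∘
F, a singleton complement gives F ∘ δ, and an empty complement gives zero. The hypothesis s ≥ 2
keeps the first two cases disjoint. -/
theorem PartialDerivatives.circTerm_eq_add (D : PartialDerivatives 𝒜 deg u)
    {c : List ι → A} (hc : IsSymbol 𝒜 deg 2 c) {δ : A →ₗ[ℂ] A} (hnil : c [] = 0)
    (hsingle : ∀ x : Homog 𝒜, D.contract [x.val] 2 c = δ x.val) {s : ℕ} (hs : 2 ≤ s)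
    (d : Fin s → ℤ) (f : Fin s → A) (hf : ∀ i, f i ∈ 𝒜 (d i)) (I : Finset (Fin s)) :
    D.circTerm c d f I = D.circTerm (truncate c) d f I +
      ((if I = ∅ then δ (D.contract ((List.finRange s).map f) 2 c) else 0) +
      ∑ i, if I = Finset.univ.erase i then D.circTerm c d f (Finset.univ.erase i) else 0) := by
  have hcard : I.card + Iᶜ.card = s := by rw [Finset.card_add_card_compl, Fintype.card_fin]
  have herase : ∀ i, I = Finset.univ.erase i ↔ Iᶜ = {i} := fun i => by
    rw [← Finset.compl_singleton, eq_compl_comm, eq_comm]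
  have hsum : Iᶜ.card ≠ 1 →
      (∑ i, if I = Finset.univ.erase i then D.circTerm c d f (Finset.univ.erase i) else 0) = 0 :=
    fun h => Finset.sum_eq_zero fun i _ => if_neg fun hI => h (by
      rw [(herase i).1 hI, Finset.card_singleton])
  have htrunc : Iᶜ.card < 2 → D.circTerm (truncate c) d f I = 0 := fun h => by
    have hinner : D.contract (Iᶜ.sort.map f) 2 (truncate c) = 0 := by
      rw [D.contract_truncate, if_pos (by simpa using h)]
    rw [circTerm, hinner, D.contract_zero_entry, smul_zero]
  rcases Nat.lt_trichotomy Iᶜ.card 1 with h | h | h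
  · have hI : I ≠ ∅ := by
      rintro rfl
      rw [Finset.card_empty] at hcard
      omega
    have hIc : Iᶜ = ∅ := Finset.card_eq_zero.1 (by omega)
    rw [htrunc (by omega), hsum (by omega), if_neg hI, circTerm, hIc, Finset.sort_empty,
      List.map_nil]
    change _ • D.contract (_ ++ [c []]) 2 c = _
    rw [hnil, D.contract_zero_entry, smul_zero, add_zero, add_zero]
  · have hI : I ≠ ∅ := by
      rintro rfl
      rw [Finset.card_empty] at hcard
      omega
    obtain ⟨i, hi⟩ := Finset.card_eq_one.1 h
    rw [htrunc (by omega), if_neg hI, Finset.sum_eq_single i, if_pos ((herase i).2 hi),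
      ← (herase i).2 hi, zero_add, zero_add]
    · exact fun j _ hj => if_neg fun h => hj (Finset.singleton_injective
        (((herase j).1 h).symm.trans hi))
    · exact fun h => absurd (Finset.mem_univ i) h
  · rw [hsum (by omega)]
    by_cases hI : I = ∅
    · subst hI
      have hmem := D.contract_mem ((List.finRange s).map fun i => (⟨d i, f i, hf i⟩ : Homog 𝒜)) hc
      rw [List.map_map] at hmem
      have hδ := hsingle ⟨_, _, hmem⟩
      change D.contract [D.contract ((List.finRange s).map f) 2 c] 2 c =
        δ (D.contract ((List.finRange s).map f) 2 c) at hδ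
      rw [if_pos rfl, circTerm, circTerm, Finset.compl_empty, Fin.sort_univ, Finset.sort_empty,
        List.map_nil, List.nil_append, List.nil_append, hδ, D.contract_truncate [_],
        if_pos (by simp), smul_zero, zero_add, add_zero]
      simp [unshuffleExponent]
    · have hpos := Finset.card_pos.2 (Finset.nonempty_iff_ne_empty.2 hI)
      rw [if_neg hI, add_zero, add_zero, circTerm, circTerm, D.contract_truncate,
        D.contract_truncate, if_neg (by simp; omega), if_neg (by simp; omega)]

theorem PartialDerivatives.isHomotopyPoisson (D : PartialDerivatives 𝒜 deg u)
    (hcomm : ∀ p q a b, a ∈ 𝒜 p → b ∈ 𝒜 q → a * b = (p * q).negOnePow • (b * a))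
    {c : List ι → A} (hc : IsSymbol 𝒜 deg 2 c) {δ : A →ₗ[ℂ] A}
    (hδ : ∀ p a, a ∈ 𝒜 p → δ a ∈ 𝒜 (p - 1)) (hnil : c [] = 0)
    (hsingle : ∀ x : Homog 𝒜, D.contract [x.val] 2 c = δ x.val)
    (hsquare : ∀ L, (D.multivector hcomm c hc).squareEval L = 0) :
    IsHomotopyPoisson δ (D.toMultivector hcomm (truncate c) hc.truncate) where
  zero_of_lt s hs := by
    ext f
    change D.contract ((List.finRange s).map f) 2 (truncate c) = 0
    rw [D.contract_truncate, if_pos (by simpa using hs)]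
  maurerCartan s hs d f hf := by
    rw [D.half_sum_schoutenEval hcomm hc.truncate, differentialEval]
    have hlen : ∀ g : Fin s → A, D.contract ((List.finRange s).map g) 2 (truncate c) =
        D.contract ((List.finRange s).map g) 2 c := fun g => by
      rw [D.contract_truncate, if_neg (by rw [List.length_map, List.length_finRange]; omega)]
    have hsum := D.squareEval_eq_sum hcomm hc d f hf
    rw [hsquare] at hsum
    have hpoint : ∀ I, D.circTerm c d f I = D.circTerm (truncate c) d f I +
        ((if I = ∅ then δ (D.contract ((List.finRange s).map f) 2 c) else 0) +
        ∑ i, if I = Finset.univ.erase i then D.circTerm c d f (Finset.univ.erase i) else 0) := by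
      exact D.circTerm_eq_add hc hnil hsingle hs d f hf
    have hzero : (0 : A) = ∑ I, D.circTerm (truncate c) d f I +
        (δ (D.contract ((List.finRange s).map f) 2 c) +
          ∑ i, D.circTerm c d f (Finset.univ.erase i)) := by
      rw [hsum, Finset.sum_congr rfl fun I _ => hpoint I, Finset.sum_add_distrib,
        Finset.sum_add_distrib, Finset.sum_comm (s := Finset.univ (α := Finset (Fin s)))]
      simp
    rw [hzero, add_comm]
    congr 1
    change δ (D.contract ((List.finRange s).map f) 2 (truncate c)) - _ = _
    rw [hlen, sub_eq_add_neg]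
    congr 1
    rw [show (2 : ℤ).negOnePow = 1 from Int.negOnePow_even 2 even_two, one_smul,
      ← Finset.sum_neg_distrib]
    refine Finset.sum_congr rfl fun i _ => ?_
    -- The sign in δ(df) = -d(δf) cancels the minus sign of the differential of a multivector of
    -- even degree.
    rw [D.circTerm_erase hcomm hc d f hf hδ hsingle, MultilinearMap.map_update_neg, smul_neg,
      neg_neg]
    congr 1
    exact hlen _

end MaurerCartan

end HoPoisson

/-! ### The theorem. -/

theorem mainTheorem1 {O : Type*} [CommRing O] [Algebra ℂ O]
    (br : O →ₗ[ℂ] O →ₗ[ℂ] O) (hbr : HoPoisson.IsPoisson br)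
    {A : Type*} [Ring A] [Algebra ℂ A] (𝒜 : ℤ → Submodule ℂ A) [GradedAlgebra 𝒜]
    (δ : A →ₗ[ℂ] A) {ι : Type*} (deg : ι → ℕ) (u : ι → A) (ε : A →ₐ[ℂ] O)
    (hres : HoPoisson.IsResolution 𝒜 δ deg u ε) :
    ∃ π : (s : ℕ) → HoPoisson.Multivector 𝒜 s 2,
      HoPoisson.IsHomotopyPoisson δ π ∧
        ∀ f g : A, ε ((π 2).toFun ![f, g]) = br (ε f) (ε g) := by
  obtain ⟨c, D, hc, hlift, hsquare⟩ := HoPoisson.exists_square_eq_zero hbr hres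
  have hnil : c [] = 0 := hres.polynomial.eq_zero_of_neg (d := -2) (by norm_num)
    (by simpa using hc.mem [])
  refine ⟨D.toMultivector hres.dga.mul_comm (HoPoisson.truncate c) hc.truncate,
    D.isHomotopyPoisson hres.dga.mul_comm hc hres.dga.map_mem hnil hlift.single hsquare, ?_⟩
  intro f g
  have hval : ∀ f g : A, (D.toMultivector hres.dga.mul_comm (HoPoisson.truncate c)
      hc.truncate 2).toFun ![f, g] = D.contract [f, g] 2 c := by
    intro f g
    change D.contract ((List.finRange 2).map ![f, g]) 2 (HoPoisson.truncate c) = _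
    rw [D.contract_truncate]
    rfl
  rw [hval]
  have hz₁ : ∀ g, D.contract [0, g] 2 c = 0 := fun g => D.contract_zero_entry [] [g] 2 c
  have hz₂ : ∀ f, D.contract [f, 0] 2 c = 0 := fun f => D.contract_zero_entry [f] [] 2 c
  have hadd₁ : ∀ f f' g, D.contract [f + f', g] 2 c = D.contract [f, g] 2 c + D.contract [f', g] 2 c :=
    fun f f' g => by simpa using D.contract_lin [] [g] 2 c 1 f f'
  have hadd₂ : ∀ f g g', D.contract [f, g + g'] 2 c = D.contract [f, g] 2 c + D.contract [f, g'] 2 c :=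
    fun f g g' => by simpa using D.contract_lin [f] [] 2 c 1 g g'
  -- The lifting property is known for homogeneous arguments; both sides are biadditive.
  induction f using DirectSum.Decomposition.inductionOn 𝒜 with
  | zero => simp [hz₁]
  | add f f' hf hf' => rw [hadd₁, map_add, hf, hf', map_add, map_add, LinearMap.add_apply]
  | homogeneous f =>
    induction g using DirectSum.Decomposition.inductionOn 𝒜 with
    | zero => simp [hz₂]
    | add g g' hg hg' => rw [hadd₂, map_add, hg, hg', map_add, map_add]
    | homogeneous g => exact hlift.pair ⟨_, f, f.2⟩ ⟨_, g, g.2⟩
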